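/- Let $d\ge 1$ be an integer and $a,b>0$. For an integer $n\ge 1$ let $\mathbb T_n^d=\mathbb Z^d/n\mathbb Z^d$, write $x\sim y$ if $x,y\in\mathbb T_n^d$ are at $\ell^1$-distance $1$, and let $\Omega_n=\{0,1\}^{\mathbb T_n^d}$. For $\eta\in\Omega_n$ let $\eta^{x,y}$ be $\eta$ with the values at $x$ and $y$ exchanged and let $\eta^x$ be $\eta$ with the value at $x$ replaced by $1-\eta_x$. For $\lambda>-a$ consider the continuous-time Markov chain on $\Omega_n$ with generator $$L_nf(\eta)=n^2\sum_{\{x,y\}:\,x\sim y}\big(f(\eta^{x,y})-f(\eta)\big)+\sum_{x\in\mathbb T_n^d}c_x(\eta)\big(f(\eta^x)-f(\eta)\big),$$ where the first sum is over unordered pairs and $$c_x(\eta)=\Big(a+\frac{\lambda}{2d}\sum_{y\sim x}\eta_y\Big)(1-\eta_x)+b\,\eta_x .$$ This chain has a unique invariant probability measure $\mu^n_{\mathrm{ss}}$. Let $\rho_*=\rho_*(a,b,\lambda)$ be the unique zero in $[0,1]$ of $F(\rho)=(a+\lambda\rho)(1-\rho)-b\rho$, let $\nu^n_{\rho_*}$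 be the Bernoulli product measure on $\Omega_n$ of density $\rho_*$, let $f^n_{\mathrm{ss}}=d\mu^n_{\mathrm{ss}}/d\nu^n_{\rho_*}$, and let $$H(f^n_{\mathrm{ss}};\nu^n_{\rho_*})=\int f^n_{\mathrm{ss}}\log f^n_{\mathrm{ss}}\,d\nu^n_{\rho_*}$$ be the relative entropy. Put $g_d(n)=n$ if $d=1$, $g_d(n)=\log n$ if $d=2$, and $g_d(n)=1$ if $d\ge 3$. Then there exist $\lambda_c=\lambda_c(a,b,d)\in(0,a)$ and a finite constant $C=C(a,b,d)$ such that $$H(f^n_{\mathrm{ss}};\nu^n_{\rho_*})\le C\,n^{d-2}g_d(n)$$ for every $\lambda\in[-\lambda_c,\lambda_c]$ and every integer $n\ge 1$ (with $n\ge 2$ if $d=2$). -/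

import Mathlib

namespace ReactionDiffusion

open scoped BigOperators

/-- The discrete torus `ℤ^d / n ℤ^d`. -/
abbrev Torus (d n : ℕ) : Type := Fin d → ZMod n

/-- Particle configurations on the torus: `η x = true` means that there is a particle at `x`. -/
abbrev Config (d n : ℕ) : Type := Torus d n → Bool

/-- Sites at distance one: `x` and `y` are different and differ by a unit step in one coordinate.
Each neighbour is counted once, also for `n = 2`; there are no neighbours for `n = 1`. -/
def Nbr {d n : ℕ} (x y : Torus d n) : Prop :=
  x ≠ y ∧ ∃ i : Fin d, y = x + Pi.single i 1 ∨ x = y + Pi.single i 1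

noncomputable section

open scoped Classical in
/-- The finite set of neighbours of `x`. -/
def nbrs {d n : ℕ} [NeZero n] (x : Torus d n) : Finset (Torus d n) :=
  Finset.univ.filter fun y => Nbr x y

/-- The occupation number of the site `x`, as a real number. -/
def occ {d n : ℕ} (η : Config d n) (x : Torus d n) : ℝ := if η x then 1 else 0

/-- The configuration `η` with the values at `x` and `y` exchanged. -/
def swapAt {d n : ℕ} (η : Config d n) (x y : Torus d n) : Config d n :=
  fun z => if z = x then η y else if z = y then η x else η z

/-- The configuration `η` with the value at `x` flipped. -/
def flipAt {d n : ℕ} (η : Config d n) (x : Torus d n) : Config d n :=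
  fun z => if z = x then !(η x) else η z

/-- The reaction rate at `x`. -/
def rate {d n : ℕ} [NeZero n] (a b l : ℝ) (x : Torus d n) (η : Config d n) : ℝ :=
  (a + l / (2 * d) * ∑ y ∈ nbrs x, occ η y) * (1 - occ η x) + b * occ η x

/-- The generator: symmetric exclusion speeded up by `n ^ 2`, plus the reaction dynamics.
The exclusion part is a sum over unordered pairs of neighbours, written as half of the sum over
ordered pairs. -/
def generator (d n : ℕ) [NeZero n] (a b l : ℝ) :
    (Config d n → ℝ) →ₗ[ℝ] (Config d n → ℝ) where
  toFun f η :=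
    (n : ℝ) ^ 2 * ((1 / 2) * ∑ x : Torus d n, ∑ y ∈ nbrs x, (f (swapAt η x y) - f η))
      + ∑ x : Torus d n, rate a b l x η * (f (flipAt η x) - f η)
  map_add' f g := by
    funext η
    simp only [Pi.add_apply, add_sub_add_comm, mul_add, Finset.sum_add_distrib]
    ring
  map_smul' c f := by
    funext η
    simp only [Pi.smul_apply, smul_eq_mul, RingHom.id_apply, ← mul_sub, ← Finset.mul_sum,
      mul_left_comm _ c, mul_add]

/-- The transition semigroup `exp (t L)` of the continuous-time Markov chain with the above
generator. -/
def semigroup (d n : ℕ) [NeZero n] (a b l t : ℝ) :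
    (Config d n → ℝ) →L[ℝ] (Config d n → ℝ) :=
  NormedSpace.exp (t • LinearMap.toContinuousLinearMap (generator d n a b l))

/-- `μ` is an invariant probability measure of the chain. Probability measures on the finite set
of configurations are given by their point masses. -/
def IsInvariantProb (d n : ℕ) [NeZero n] (a b l : ℝ) (μ : Config d n → ℝ) : Prop :=
  μ ∈ stdSimplex ℝ (Config d n) ∧
    ∀ t : ℝ, 0 ≤ t → ∀ f : Config d n → ℝ,
      ∑ η, μ η * semigroup d n a b l t f η = ∑ η, μ η * f η

/-- The Bernoulli product measure of density `ρ`. -/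
def bernoulliProd (d n : ℕ) [NeZero n] (ρ : ℝ) (η : Config d n) : ℝ :=
  ∏ x : Torus d n, (occ η x * ρ + (1 - occ η x) * (1 - ρ))

/-- The density of `μ` with respect to `ν` (used for `ν` charging every configuration). -/
def density {d n : ℕ} (μ ν : Config d n → ℝ) (η : Config d n) : ℝ := μ η / ν η

/-- The relative entropy `H (f; ν) = ∫ f log f dν` of a density `f` with respect to `ν`. -/
def relEntropy {d n : ℕ} [NeZero n] (f ν : Config d n → ℝ) : ℝ :=
  ∑ η, ν η * (f η * Real.log (f η))

/-- The reaction function. -/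
def reactionF (a b l ρ : ℝ) : ℝ := (a + l * ρ) * (1 - ρ) - b * ρ

/-- `g d n` is `n`, `log n`, `1` for `d = 1`, `d = 2`, `d ≥ 3`. -/
def greenOrder (d n : ℕ) : ℝ := if d = 1 then n else if d = 2 then Real.log n else 1

end

end ReactionDiffusion

/-! Write `ω = η - ρ` for the centred configuration, `A` for the nearest-neighbour sum and `f` for
the stationary density relative to the product measure. Testing stationarity against `log f` shows
that `n²` times the exclusion energy plus `c` times the flip energy of `√f` is at most `ε E[⟨ω, Aω⟩
f]`, where `c` bounds the rates from below and `ε = l / (2dρ)` (`energy_le_of_invariant`). Exclusion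
preserves the product measure, and `F(ρ) = 0` removes the constant and linear terms of the reaction,
so only a quadratic form in `ω` remains.

That form has about `n^d` terms and must be bounded by the entropy `H` and a much smaller error. Let
`G` be the inverse of `1 - n²Δ` and put `u = Gω`. Substituting `Aω = (1 - n²Δ)Au` and summing by
parts (`sum_mul_adjOp_eq`) leaves three pieces. The first is at most `2d⟨ω, Gω⟩`. The second is a
sum over bonds of the gradient of `ω` times a flux that does not see the endpoints of the bond;
exchanging the endpoints trades it for a quarter of the exclusion energy plus the squared flux,
which is again of order `⟨ω, Gω⟩ + tr G`. The third is a diagonal term of order `tr G`. This is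
`abs_sum_correlation_le`.

The entropy inequality `sum_mul_le_entropy_add_log` and the exponential moment bound
`sum_prodWt_exp_greenForm_le` give `E[⟨ω, Gω⟩ f] ≤ H + tr G`. The logarithmic Sobolev inequality
`entropy_le_flipEnergy` bounds `H` by twice the flip energy. For small `ε` the terms in `H` and in
the exclusion energy are absorbed, and `H ≤ C tr G` follows (`relEntropy_le_greenTrace`). Finally
`tr G = ∑ 1 / (1 + n² λ_m)`, over the Laplacian eigenvalues `λ_m`, has the required order
(`greenTrace_le`). The cases `n ≤ 2` are covered by a crude bound. -/

namespace ReactionDiffusion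

/-! ### Stationary measures of finite Markov chains. -/

section FiniteChain

variable {Ω : Type*} [Fintype Ω]

/-- Stationarity of the weight `m` for the jump rates `q`: inflow equals outflow at each state. -/
def Balanced (q : Ω → Ω → ℝ) (m : Ω → ℝ) : Prop :=
  ∀ y, ∑ x, m x * q x y = m y * ∑ x, q y x

theorem sum_mul_jump (q : Ω → Ω → ℝ) (m f : Ω → ℝ) :
    ∑ x, m x * ∑ y, q x y * (f y - f x)
      = ∑ y, (∑ x, m x * q x y - m y * ∑ x, q y x) * f y := by
  simp only [mul_sub, sub_mul, Finset.sum_sub_distrib, Finset.mul_sum, Finset.sum_mul]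
  congr 1
  · rw [Finset.sum_comm]
    exact Finset.sum_congr rfl fun y _ => Finset.sum_congr rfl fun x _ => by ring
  · exact Finset.sum_congr rfl fun y _ => Finset.sum_congr rfl fun x _ => by ring

theorem balanced_iff (q : Ω → Ω → ℝ) (m : Ω → ℝ) :
    Balanced q m ↔ ∀ f : Ω → ℝ, ∑ x, m x * ∑ y, q x y * (f y - f x) = 0 := by
  constructor
  · intro h f
    rw [sum_mul_jump]
    exact Finset.sum_eq_zero fun y _ => by rw [h y]; ring
  · intro h y
    classical
    have := h (Pi.single y 1)
    rw [sum_mul_jump, Finset.sum_eq_single y] at this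
    · simp at this; linarith
    · intro z _ hz; simp [hz]
    · simp

/-- A state without mass has no outflow, hence no inflow; every term of the inflow is nonnegative,
so each state with a positive rate into it is massless too. Irreducibility spreads this to all
states. -/
theorem Balanced.eq_zero_of_nonneg {q : Ω → Ω → ℝ} (hq : ∀ x y, 0 ≤ q x y)
    (hirr : ∀ x y, Relation.ReflTransGen (fun u v => 0 < q u v) x y)
    {m : Ω → ℝ} (hm : Balanced q m) (h0 : ∀ x, 0 ≤ m x) {z : Ω} (hz : m z = 0) (x : Ω) :
    m x = 0 := by
  induction hirr x z using Relation.ReflTransGen.head_induction_on with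
  | refl => exact hz
  | @head u v huv _ ih =>
    have := hm v
    rw [ih, zero_mul, Finset.sum_eq_zero_iff_of_nonneg
      (fun x _ => mul_nonneg (h0 x) (hq x v))] at this
    have := this u (Finset.mem_univ u)
    rcases mul_eq_zero.1 this with h | h
    · exact h
    · exact absurd h huv.ne'

theorem Balanced.pos {q : Ω → Ω → ℝ} (hq : ∀ x y, 0 ≤ q x y)
    (hirr : ∀ x y, Relation.ReflTransGen (fun u v => 0 < q u v) x y)
    {m : Ω → ℝ} (hm : Balanced q m) (h : m ∈ stdSimplex ℝ Ω) (x : Ω) : 0 < m x := by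
  refine lt_of_le_of_ne (h.1 x) fun hx => ?_
  have h1 := h.2
  rw [Finset.sum_eq_zero fun y _ => hm.eq_zero_of_nonneg hq hirr h.1 hx.symm y] at h1
  exact zero_ne_one h1

/-- Subtract from `m` the largest multiple of `m'` that leaves a nonnegative weight. The difference
is balanced and vanishes somewhere, hence everywhere, and normalization makes the multiple 1. -/
theorem Balanced.unique [Nonempty Ω] {q : Ω → Ω → ℝ} (hq : ∀ x y, 0 ≤ q x y)
    (hirr : ∀ x y, Relation.ReflTransGen (fun u v => 0 < q u v) x y)
    {m m' : Ω → ℝ} (hm : Balanced q m) (h : m ∈ stdSimplex ℝ Ω)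
    (hm' : Balanced q m') (h' : m' ∈ stdSimplex ℝ Ω) : m = m' := by
  obtain ⟨z, hz⟩ := Finite.exists_min (fun x => m x / m' x)
  have hp := hm'.pos hq hirr h'
  set t := m z / m' z with ht
  have hb : Balanced q (fun x => m x - t * m' x) := by
    intro y
    simp only [sub_mul, Finset.sum_sub_distrib, mul_assoc, ← Finset.mul_sum]
    rw [hm y, hm' y]
  have h0 : ∀ x, 0 ≤ m x - t * m' x := fun x => by
    have := hz x
    rw [le_div_iff₀ (hp x)] at this
    linarith
  have hzz : m z - t * m' z = 0 := by
    rw [ht, div_mul_cancel₀ _ (hp z).ne', sub_self]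
  have key : ∀ x, m x = t * m' x := fun x =>
    sub_eq_zero.1 (hb.eq_zero_of_nonneg hq hirr h0 hzz x)
  have ht1 : t = 1 := by
    have h1 := h.2
    simp only [key, ← Finset.mul_sum] at h1
    rwa [h'.2, mul_one] at h1
  funext x
  rw [key, ht1, one_mul]

/-- The rate matrix kills constants, so it has a nonzero left null vector `v`, possibly of mixed
sign. By the triangle inequality the outflow of `|v|` is at most its inflow at each state; both have
the same total, so equality holds and `|v|` is balanced. -/
theorem exists_balanced [Nonempty Ω] {q : Ω → Ω → ℝ} (hq : ∀ x y, 0 ≤ q x y) :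
    ∃ m ∈ stdSimplex ℝ Ω, Balanced q m := by
  classical
  let M : Matrix Ω Ω ℝ := Matrix.of fun x y => q x y - if x = y then ∑ z, q x z else 0
  have hM : M.mulVec (fun _ => 1) = 0 := by
    funext x
    simp [M, Matrix.mulVec, dotProduct]
  have hdet : M.det = 0 := by
    rw [← Matrix.exists_mulVec_eq_zero_iff]
    exact ⟨fun _ => 1, fun h => by simpa using congrFun h (Classical.arbitrary Ω), hM⟩
  rw [← Matrix.det_transpose, ← Matrix.exists_mulVec_eq_zero_iff] at hdet
  obtain ⟨v, hv0, hv⟩ := hdet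
  have hvb : Balanced q v := by
    intro y
    have := congrFun hv y
    simp only [M, Matrix.mulVec, dotProduct, Matrix.transpose_apply, Matrix.of_apply, Pi.zero_apply, sub_mul,
      Finset.sum_sub_distrib, ite_mul, zero_mul, Finset.sum_ite_eq', Finset.mem_univ,
      if_true] at this
    rw [sub_eq_zero, mul_comm (∑ z, q y z)] at this
    rw [← this]
    exact Finset.sum_congr rfl fun x _ => mul_comm _ _
  have hle : ∀ y, |v y| * ∑ x, q y x ≤ ∑ x, |v x| * q x y := by
    intro y
    calc |v y| * ∑ x, q y x = |v y * ∑ x, q y x| := by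
          rw [abs_mul, abs_of_nonneg (Finset.sum_nonneg fun x _ => hq y x)]
      _ = |∑ x, v x * q x y| := by rw [hvb y]
      _ ≤ ∑ x, |v x * q x y| := Finset.abs_sum_le_sum_abs _ _
      _ = _ := Finset.sum_congr rfl fun x _ => by rw [abs_mul, abs_of_nonneg (hq x y)]
  have hsum : ∑ y, |v y| * ∑ x, q y x = ∑ y, ∑ x, |v x| * q x y := by
    rw [Finset.sum_comm]
    exact Finset.sum_congr rfl fun y _ => by rw [Finset.mul_sum]
  have heq := (Finset.sum_eq_sum_iff_of_le fun y _ => hle y).1 hsum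
  have hpos : 0 < ∑ y, |v y| := by
    obtain ⟨z, hz⟩ := Function.ne_iff.1 hv0
    exact Finset.sum_pos' (fun y _ => abs_nonneg _) ⟨z, Finset.mem_univ z, abs_pos.2 hz⟩
  refine ⟨fun x => |v x| / ∑ y, |v y|, ⟨fun x => by positivity, ?_⟩, fun y => ?_⟩
  · rw [← Finset.sum_div, div_self hpos.ne']
  · simp only [div_mul_eq_mul_div, ← Finset.sum_div]
    rw [heq y (Finset.mem_univ y)]

end FiniteChain

/-! ### Invariance under the semigroup and under its generator. -/

/-- A linear functional is preserved by `exp (t L)` for all `t ≥ 0` iff it vanishes on the range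
of `L`. -/
theorem forall_exp_apply_eq_iff {E : Type*} [NormedAddCommGroup E] [NormedSpace ℝ E]
    [CompleteSpace E] (L : E →L[ℝ] E) (φ : E →L[ℝ] ℝ) :
    (∀ t : ℝ, 0 ≤ t → ∀ f, φ (NormedSpace.exp (t • L) f) = φ f) ↔ ∀ f, φ (L f) = 0 := by
  have hd : ∀ (t : ℝ) (f : E), HasDerivAt (fun s : ℝ => φ (NormedSpace.exp (s • L) f))
      (φ (L (NormedSpace.exp (t • L) f))) t := by
    intro t f
    have h := hasDerivAt_exp_smul_const' (𝕂 := ℝ) L t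
    have h2 := h.clm_apply (hasDerivAt_const t f)
    have h3 := φ.hasFDerivAt.comp_hasDerivAt t h2
    simp only [mul_apply_eq_comp, map_zero, add_zero] at h3
    exact h3
  constructor
  · intro h f
    have h1 : HasDerivWithinAt (fun s : ℝ => φ (NormedSpace.exp (s • L) f))
        (φ (L (NormedSpace.exp ((0:ℝ) • L) f))) (Set.Ici 0) 0 := (hd 0 f).hasDerivWithinAt
    have h2 : HasDerivWithinAt (fun s : ℝ => φ (NormedSpace.exp (s • L) f)) 0 (Set.Ici 0) 0 := by
      refine (hasDerivWithinAt_const (0:ℝ) (Set.Ici 0) (φ f)).congr (fun s hs => h s hs f) ?_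
      exact h 0 le_rfl f
    have h3 := (uniqueDiffOn_Ici (0:ℝ) 0 Set.self_mem_Ici).eq_deriv _ h1 h2
    simpa using h3
  · intro h t _ f
    have hdiff : Differentiable ℝ fun s : ℝ => φ (NormedSpace.exp (s • L) f) :=
      fun s => (hd s f).differentiableAt
    have := is_const_of_deriv_eq_zero hdiff (fun s => by rw [(hd s f).deriv, h]) t 0
    simpa using this

/-! ### Logarithmic Sobolev inequality for Bernoulli products. -/

section Product

variable {S : Type*} [Fintype S] [DecidableEq S]

/-- The weights of the Bernoulli law of parameter `ρ`. -/
noncomputable def bernWt (ρ : ℝ) (s : Bool) : ℝ := if s then ρ else 1 - ρ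

/-- The point masses of the product of Bernoulli laws. -/
noncomputable def prodWt (ρ : ℝ) (η : S → Bool) : ℝ := ∏ x, bernWt ρ (η x)

/-- The configuration with the value at `x` flipped. -/
def flipSite (x : S) (η : S → Bool) : S → Bool := Function.update η x (!η x)

/-- The average over the value at `y`. -/
noncomputable def siteAvg (ρ : ℝ) (y : S) (f : (S → Bool) → ℝ) (η : S → Bool) : ℝ :=
  ρ * f (Function.update η y true) + (1 - ρ) * f (Function.update η y false)

omit [Fintype S] in
theorem flipSite_involutive (x : S) : Function.Involutive (flipSite x) := by
  intro η
  simp [flipSite]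

theorem bernWt_nonneg {ρ : ℝ} (h0 : 0 ≤ ρ) (h1 : ρ ≤ 1) (s : Bool) : 0 ≤ bernWt ρ s := by
  unfold bernWt; split_ifs <;> linarith

omit [DecidableEq S] in
theorem prodWt_nonneg {ρ : ℝ} (h0 : 0 ≤ ρ) (h1 : ρ ≤ 1) (η : S → Bool) : 0 ≤ prodWt ρ η :=
  Finset.prod_nonneg fun _ _ => bernWt_nonneg h0 h1 _

theorem sum_prodWt_mul_prod (ρ : ℝ) (g : S → Bool → ℝ) :
    ∑ η : S → Bool, prodWt ρ η * ∏ x, g x (η x)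
      = ∏ x, (ρ * g x true + (1 - ρ) * g x false) := by
  have := (Finset.prod_univ_sum (fun _ : S => (Finset.univ : Finset Bool))
    (fun x s => bernWt ρ s * g x s)).symm
  simp only [Fintype.piFinset_univ, Finset.prod_mul_distrib] at this
  simpa [prodWt, bernWt] using this

theorem sum_prodWt (ρ : ℝ) : ∑ η : S → Bool, prodWt ρ η = 1 := by
  have := sum_prodWt_mul_prod (S := S) ρ (fun _ _ => 1)
  simpa using this

/-- The change of measure under a flip, multiplied out so that it holds for every `ρ` without
dividing by a weight. -/
theorem prodWt_flipSite (ρ : ℝ) (x : S) (η : S → Bool) :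
    prodWt ρ (flipSite x η) * bernWt ρ (η x) = prodWt ρ η * bernWt ρ (!η x) := by
  unfold prodWt
  rw [← Finset.mul_prod_erase _ _ (Finset.mem_univ x),
    ← Finset.mul_prod_erase _ (fun y => bernWt ρ (η y)) (Finset.mem_univ x)]
  have : ∏ y ∈ Finset.univ.erase x, bernWt ρ (flipSite x η y)
      = ∏ y ∈ Finset.univ.erase x, bernWt ρ (η y) :=
    Finset.prod_congr rfl fun y hy => by
      simp [flipSite, Function.update_of_ne (Finset.ne_of_mem_erase hy)]
  rw [this]
  simp [flipSite]
  ring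

omit [Fintype S] in
theorem siteAvg_eq (ρ : ℝ) (y : S) (f : (S → Bool) → ℝ) (η : S → Bool) :
    siteAvg ρ y f η = bernWt ρ (η y) * f η + bernWt ρ (!η y) * f (flipSite y η) := by
  have h : Function.update η y (η y) = η := Function.update_eq_self y η
  unfold siteAvg flipSite bernWt
  cases hy : η y <;> rw [hy] at h <;> simp [h] ; ring

theorem sum_prodWt_siteAvg (ρ : ℝ) (y : S) (f : (S → Bool) → ℝ) :
    ∑ η, prodWt ρ η * siteAvg ρ y f η = ∑ η, prodWt ρ η * f η := by
  have h1 : ∑ η, prodWt ρ η * (bernWt ρ (!η y) * f (flipSite y η))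
      = ∑ η, prodWt ρ η * (bernWt ρ (!η y) * f η) := by
    rw [← (flipSite_involutive y).bijective.sum_comp
      (fun η => prodWt ρ η * (bernWt ρ (!η y) * f η))]
    refine Finset.sum_congr rfl fun η _ => ?_
    rw [← mul_assoc, ← prodWt_flipSite, ← mul_assoc]
    simp [flipSite]
  simp only [siteAvg_eq, mul_add, Finset.sum_add_distrib, h1]
  rw [← Finset.sum_add_distrib]
  refine Finset.sum_congr rfl fun η _ => ?_
  have : bernWt ρ (η y) + bernWt ρ (!η y) = 1 := by
    cases η y <;> simp [bernWt]
  linear_combination prodWt ρ η * f η * this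

/-- Applying `log y ≤ y - 1` to `u / m` and `v / m`, with `m` the mean, bounds the entropy by the
variance over `m`, that is `αβ(u - v)² / m`. Factoring `u - v` through square roots leaves `αβ(√u +
√v)² ≤ 2m`. -/
theorem two_point_entropy_le {α β u v : ℝ} (hα : 0 ≤ α) (hβ : 0 ≤ β) (hαβ : α + β = 1)
    (hu : 0 ≤ u) (hv : 0 ≤ v) :
    α * (u * Real.log u) + β * (v * Real.log v)
      ≤ (α * u + β * v) * Real.log (α * u + β * v) + 2 * (√u - √v) ^ 2 := by
  set m := α * u + β * v with hm
  have hm0 : 0 ≤ m := by positivity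
  rcases hm0.eq_or_lt with h | h
  · have h1 : α * u = 0 := by nlinarith [mul_nonneg hα hu, mul_nonneg hβ hv]
    have h2 : β * v = 0 := by nlinarith [mul_nonneg hα hu, mul_nonneg hβ hv]
    rw [← mul_assoc, ← mul_assoc, h1, h2, ← h]
    simp; positivity
  · have key : ∀ w : ℝ, 0 ≤ w → w * Real.log w ≤ w * Real.log m + w * (w / m - 1) := by
      intro w hw
      rcases hw.eq_or_lt with h' | h'
      · simp [← h']
      · have := Real.log_le_sub_one_of_pos (div_pos h' h)
        rw [Real.log_div h'.ne' h.ne'] at this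
        nlinarith
    have h1 := mul_le_mul_of_nonneg_left (key u hu) hα
    have h2 := mul_le_mul_of_nonneg_left (key v hv) hβ
    have h3 : α * (u * (u / m - 1)) + β * (v * (v / m - 1)) = α * β * (u - v) ^ 2 / m := by
      have hβ' : β = 1 - α := by linarith
      field_simp
      rw [hm, hβ']
      ring
    have h4 : α * β * (u - v) ^ 2 / m ≤ 2 * (√u - √v) ^ 2 := by
      rw [div_le_iff₀ h]
      have hs := Real.sq_sqrt hu
      have ht := Real.sq_sqrt hv
      set s := √u
      set t := √v
      have e : α * β * (u - v) ^ 2 = (s - t) ^ 2 * (α * β * (s + t) ^ 2) := by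
        rw [← hs, ← ht]; ring
      rw [e]
      have : α * β * (s + t) ^ 2 ≤ 2 * m := by
        have hle : (s + t) ^ 2 ≤ 2 * (u + v) := by nlinarith [sq_nonneg (s - t)]
        have h5 : α * β ≤ α := by nlinarith
        have h6 : α * β ≤ β := by nlinarith
        calc α * β * (s + t) ^ 2 ≤ α * β * (2 * (u + v)) :=
              mul_le_mul_of_nonneg_left hle (mul_nonneg hα hβ)
          _ = 2 * (α * β * u + α * β * v) := by ring
          _ ≤ 2 * m := by
              have := mul_le_mul_of_nonneg_right h5 hu
              have := mul_le_mul_of_nonneg_right h6 hv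
              linarith
      nlinarith [mul_le_mul_of_nonneg_left this (sq_nonneg (s - t))]
    nlinarith

/-- After expanding the squares, only the cross terms matter, and these compare by the
Cauchy–Schwarz inequality. By homogeneity, the weights need not sum to 1. -/
theorem sq_sqrt_sub_sqrt_convex {α β u₁ u₂ v₁ v₂ : ℝ} (hα : 0 ≤ α) (hβ : 0 ≤ β)
    (hu₁ : 0 ≤ u₁) (hu₂ : 0 ≤ u₂) (hv₁ : 0 ≤ v₁) (hv₂ : 0 ≤ v₂) :
    (√(α * u₁ + β * u₂) - √(α * v₁ + β * v₂)) ^ 2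
      ≤ α * (√u₁ - √v₁) ^ 2 + β * (√u₂ - √v₂) ^ 2 := by
  have hA : 0 ≤ α * u₁ + β * u₂ := by positivity
  have hB : 0 ≤ α * v₁ + β * v₂ := by positivity
  have key : α * (√u₁ * √v₁) + β * (√u₂ * √v₂)
      ≤ √(α * u₁ + β * u₂) * √(α * v₁ + β * v₂) := by
    rw [← Real.sqrt_mul hA]
    refine Real.le_sqrt_of_sq_le ?_
    have e1 := Real.sq_sqrt hu₁
    have e2 := Real.sq_sqrt hu₂
    have e3 := Real.sq_sqrt hv₁
    have e4 := Real.sq_sqrt hv₂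
    set a := √u₁
    set b := √u₂
    set c := √v₁
    set d := √v₂
    rw [← e1, ← e2, ← e3, ← e4]
    nlinarith [mul_nonneg (mul_nonneg hα hβ) (sq_nonneg (a * d - b * c))]
  have e1 := Real.sq_sqrt hu₁
  have e2 := Real.sq_sqrt hu₂
  have e3 := Real.sq_sqrt hv₁
  have e4 := Real.sq_sqrt hv₂
  have e5 := Real.sq_sqrt hA
  have e6 := Real.sq_sqrt hB
  simp only [sub_sq]
  rw [e1, e2, e3, e4, e5, e6]
  linarith

/-- The Dirichlet form of the flip at `x`, for the square root of a density. -/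
noncomputable def flipEnergy (ρ : ℝ) (x : S) (f : (S → Bool) → ℝ) : ℝ :=
  ∑ η, prodWt ρ η * (√(f (flipSite x η)) - √(f η)) ^ 2

omit [Fintype S] in
theorem sq_flipSite (x : S) (f : (S → Bool) → ℝ) (η : S → Bool) :
    (√(f (flipSite x η)) - √(f η)) ^ 2
      = (√(f (Function.update η x true)) - √(f (Function.update η x false))) ^ 2 := by
  have h : Function.update η x (η x) = η := Function.update_eq_self x η
  unfold flipSite
  cases hx : η x <;> rw [hx] at h <;> simp [h]
  ring

omit [Fintype S] in
theorem siteAvg_nonneg {ρ : ℝ} (h0 : 0 ≤ ρ) (h1 : ρ ≤ 1) (y : S) {f : (S → Bool) → ℝ}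
    (hf : ∀ η, 0 ≤ f η) (η : S → Bool) : 0 ≤ siteAvg ρ y f η := by
  have := sub_nonneg.2 h1
  have := hf (Function.update η y true)
  have := hf (Function.update η y false)
  unfold siteAvg; positivity

/-- Averaging at another site commutes with the flip at `x`, and the integrand is jointly convex, so
averaging cannot raise the energy. -/
theorem flipEnergy_siteAvg_le {ρ : ℝ} (h0 : 0 ≤ ρ) (h1 : ρ ≤ 1) {x y : S} (hxy : x ≠ y)
    {f : (S → Bool) → ℝ} (hf : ∀ η, 0 ≤ f η) :
    flipEnergy ρ x (siteAvg ρ y f) ≤ flipEnergy ρ x f := by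
  unfold flipEnergy
  rw [← sum_prodWt_siteAvg ρ y (fun η => (√(f (flipSite x η)) - √(f η)) ^ 2)]
  refine Finset.sum_le_sum fun η _ => mul_le_mul_of_nonneg_left ?_ (prodWt_nonneg h0 h1 η)
  rw [sq_flipSite]
  simp only [siteAvg, sq_flipSite, Function.update_comm hxy]
  exact sq_sqrt_sub_sqrt_convex h0 (sub_nonneg.2 h1) (hf _) (hf _) (hf _) (hf _)

theorem entropy_le_siteAvg {ρ : ℝ} (h0 : 0 ≤ ρ) (h1 : ρ ≤ 1) (y : S)
    {f : (S → Bool) → ℝ} (hf : ∀ η, 0 ≤ f η) :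
    ∑ η, prodWt ρ η * (f η * Real.log (f η))
      ≤ ∑ η, prodWt ρ η * (siteAvg ρ y f η * Real.log (siteAvg ρ y f η))
        + 2 * flipEnergy ρ y f := by
  unfold flipEnergy
  rw [← sum_prodWt_siteAvg ρ y (fun η => f η * Real.log (f η)), Finset.mul_sum,
    ← Finset.sum_add_distrib]
  refine Finset.sum_le_sum fun η _ => ?_
  have := two_point_entropy_le h0 (sub_nonneg.2 h1) (by ring)
    (hf (Function.update η y true)) (hf (Function.update η y false))
  have := mul_le_mul_of_nonneg_left this (prodWt_nonneg h0 h1 η)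
  rw [sq_flipSite]
  unfold siteAvg
  linarith

/-- Tensorization: averaging out one site of `A` costs twice its flip energy, and the energies of
the remaining sites do not grow. Once all relevant sites are averaged, the function is constant. -/
theorem entropy_le_flipEnergy_of_dependsOn {ρ : ℝ} (h0 : 0 ≤ ρ) (h1 : ρ ≤ 1) (A : Finset S) :
    ∀ f : (S → Bool) → ℝ, (∀ η, 0 ≤ f η) →
      (∀ x ∉ A, ∀ η s, f (Function.update η x s) = f η) →
      ∑ η, prodWt ρ η * (f η * Real.log (f η))
        ≤ (∑ η, prodWt ρ η * f η) * Real.log (∑ η, prodWt ρ η * f η)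
          + 2 * ∑ x ∈ A, flipEnergy ρ x f := by
  induction A using Finset.induction_on with
  | empty =>
    intro f hf hdep
    have hconst : ∀ η, f η = f fun _ => false := by
      have : ∀ (B : Finset S) (η : S → Bool),
          f (fun x => if x ∈ B then false else η x) = f η := by
        intro B η
        induction B using Finset.induction_on with
        | empty => simp
        | insert z B _ ih =>
          rw [← ih, ← hdep z (by simp) (fun x => if x ∈ B then false else η x) false]
          congr 1
          funext x
          by_cases hx : x = z
          · subst hx; simp
          · simp [hx]
      intro η
      rw [← this Finset.univ η]
      simp
    generalize f (fun _ => false) = c at hconst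
    simp only [hconst, ← Finset.sum_mul, sum_prodWt]
    simp
  | insert y A hy ih =>
    intro f hf hdep
    have hstep := entropy_le_siteAvg h0 h1 y hf
    have hrec := ih (siteAvg ρ y f) (siteAvg_nonneg h0 h1 y hf) (by
      intro x hx η s
      unfold siteAvg
      by_cases hxy : x = y
      · subst hxy; simp
      · simp only [Function.update_comm hxy]
        rw [hdep x (by simp [hx, hxy]), hdep x (by simp [hx, hxy])])
    rw [sum_prodWt_siteAvg] at hrec
    have hle : ∑ x ∈ A, flipEnergy ρ x (siteAvg ρ y f) ≤ ∑ x ∈ A, flipEnergy ρ x f :=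
      Finset.sum_le_sum fun x hx =>
        flipEnergy_siteAvg_le h0 h1 (ne_of_mem_of_not_mem hx hy) hf
    rw [Finset.sum_insert hy]
    linarith

/-- Logarithmic Sobolev inequality for product Bernoulli measures. -/
theorem entropy_le_flipEnergy {ρ : ℝ} (h0 : 0 ≤ ρ) (h1 : ρ ≤ 1) {f : (S → Bool) → ℝ}
    (hf : ∀ η, 0 ≤ f η) (hf1 : ∑ η, prodWt ρ η * f η = 1) :
    ∑ η, prodWt ρ η * (f η * Real.log (f η)) ≤ 2 * ∑ x, flipEnergy ρ x f := by
  have := entropy_le_flipEnergy_of_dependsOn h0 h1 Finset.univ f hf (by simp)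
  rw [hf1] at this
  simpa using this

end Product

/-- The entropy inequality on a finite set. -/
theorem sum_mul_le_entropy_add_log {Ω : Type*} [Fintype Ω] {w f : Ω → ℝ} (φ : Ω → ℝ)
    (hw : ∀ x, 0 < w x) (hf : ∀ x, 0 < f x) (hf1 : ∑ x, w x * f x = 1) {c : ℝ}
    (hφ : ∑ x, w x * Real.exp (φ x) ≤ Real.exp c) :
    ∑ x, w x * (φ x * f x) ≤ ∑ x, w x * (f x * Real.log (f x)) + c := by
  have h : ∀ x, w x * (φ x * f x)
      ≤ w x * (f x * Real.log (f x)) + w x * f x * c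
        + (w x * Real.exp (φ x) * Real.exp (-c) - w x * f x) := by
    intro x
    -- Gibbs variational principle: the exponential tilt `exp (φ - c)` is compared with `f`
    -- pointwise.
    have h1 := Real.add_one_le_exp (φ x - c - Real.log (f x))
    rw [Real.exp_sub, Real.exp_log (hf x), sub_eq_add_neg (φ x), Real.exp_add,
      le_div_iff₀ (hf x)] at h1
    nlinarith [mul_le_mul_of_nonneg_left h1 (hw x).le]
  have hs := Finset.sum_le_sum fun x (_ : x ∈ Finset.univ) => h x
  simp only [Finset.sum_add_distrib, Finset.sum_sub_distrib, ← Finset.sum_mul, hf1] at hs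
  have : (∑ x, w x * Real.exp (φ x)) * Real.exp (-c) ≤ 1 := by
    calc _ ≤ Real.exp c * Real.exp (-c) := mul_le_mul_of_nonneg_right hφ (Real.exp_pos _).le
      _ = 1 := by rw [← Real.exp_add]; simp
  linarith

/-! ### Exponential moments of quadratic forms by Gaussian linearization. -/

section Gaussian

open MeasureTheory ProbabilityTheory

/-- Hoeffding's lemma for a centred Bernoulli variable. -/
theorem bernoulli_mgf_le {ρ : ℝ} (h0 : 0 ≤ ρ) (h1 : ρ ≤ 1) (t : ℝ) :
    ρ * Real.exp (t * (1 - ρ)) + (1 - ρ) * Real.exp (t * (0 - ρ)) ≤ Real.exp (t ^ 2 / 8) := by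
  let μ : Measure Bool := ENNReal.ofReal ρ • Measure.dirac true
    + ENNReal.ofReal (1 - ρ) • Measure.dirac false
  have h1' : 0 ≤ 1 - ρ := sub_nonneg.2 h1
  have hμ : IsProbabilityMeasure μ := ⟨by
    simp only [μ, Measure.add_apply, Measure.smul_apply, measure_univ, smul_eq_mul, mul_one]
    rw [← ENNReal.ofReal_add h0 h1']
    simp⟩
  have hintg : ∀ g : Bool → ℝ, ∫ s, g s ∂μ = ρ * g true + (1 - ρ) * g false := by
    intro g
    rw [integral_add_measure (Integrable.of_finite.smul_measure ENNReal.ofReal_ne_top)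
        (Integrable.of_finite.smul_measure ENNReal.ofReal_ne_top),
      integral_smul_measure, integral_smul_measure, integral_dirac, integral_dirac,
      ENNReal.toReal_ofReal h0, ENNReal.toReal_ofReal h1']
    simp
  let X : Bool → ℝ := fun s => (if s then 1 else 0) - ρ
  have hX : ∀ᵐ s ∂μ, X s ∈ Set.Icc (0 - ρ) (1 - ρ) :=
    Filter.Eventually.of_forall fun s => by
      cases s <;> simp [X]
  have hX0 : μ[X] = 0 := by
    rw [hintg]; simp [X]; ring
  have := (hasSubgaussianMGF_of_mem_Icc_of_integral_eq_zero
    (measurable_of_finite X).aemeasurable hX hX0).mgf_le t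
  rw [mgf, hintg] at this
  simp only [X, if_true, Bool.false_eq_true, if_false] at this
  refine this.trans_eq ?_
  congr 1
  norm_num
  ring

theorem integral_exp_mul_sq_gaussianReal {c : ℝ} (hc : c < 1 / 2) :
    ∫ x, Real.exp (c * x ^ 2) ∂(gaussianReal 0 1) = √(1 / (1 - 2 * c)) := by
  rw [integral_gaussianReal_eq_integral_smul (by norm_num)]
  have h : ∀ x : ℝ, gaussianPDFReal 0 1 x • Real.exp (c * x ^ 2)
      = (√(2 * Real.pi))⁻¹ * Real.exp (-(1 / 2 - c) * x ^ 2) := by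
    intro x
    rw [gaussianPDFReal, smul_eq_mul, mul_assoc, ← Real.exp_add, NNReal.coe_one, mul_one]
    congr 2
    ring
  simp only [h]
  rw [integral_const_mul, integral_gaussian, ← Real.sqrt_inv, ← Real.sqrt_mul (by positivity)]
  congr 1
  have : (1 : ℝ) - 2 * c ≠ 0 := by linarith
  have : (1 : ℝ) / 2 - c ≠ 0 := by intro h; apply this; linarith
  have := Real.pi_ne_zero
  field_simp

theorem integrable_exp_mul_sq_gaussianReal {c : ℝ} (hc : c < 1 / 2) :
    Integrable (fun x => Real.exp (c * x ^ 2)) (gaussianReal 0 1) := by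
  -- A non-integrable function has Bochner integral 0 by convention, so the nonzero value already
  -- computed proves integrability.
  refine Integrable.of_integral_ne_zero ?_
  rw [integral_exp_mul_sq_gaussianReal hc]
  have : 0 < 1 - 2 * c := by linarith
  positivity

theorem integral_exp_mul_sq_gaussianReal_le {c : ℝ} (h0 : 0 ≤ c) (hc : c ≤ 1 / 4) :
    ∫ x, Real.exp (c * x ^ 2) ∂(gaussianReal 0 1) ≤ Real.exp (4 * c) := by
  rw [integral_exp_mul_sq_gaussianReal (by linarith)]
  have hp : 0 < 1 - 2 * c := by linarith
  rw [Real.sqrt_le_left (Real.exp_pos _).le, ← Real.exp_nat_mul, div_le_iff₀ hp]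
  -- After squaring, the claim is `1 ≤ exp (8c) (1 - 2c)`; here `(1 + 8c)(1 - 2c) ≥ 1` because `c ≤
  -- 1/4`.
  have := Real.add_one_le_exp ((2 : ℕ) * (4 * c))
  push_cast at this ⊢
  nlinarith

theorem integral_exp_mul_gaussianReal (t : ℝ) :
    ∫ x, Real.exp (t * x) ∂(gaussianReal 0 1) = Real.exp (t ^ 2 / 2) := by
  have := mgf_gaussianReal (p := gaussianReal 0 1) (X := id) (μ := 0) (v := 1) Measure.map_id t
  rw [mgf] at this
  simpa using this

variable {S : Type*} [Fintype S] [DecidableEq S]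

/-- The value of a bit, centred at `ρ`. -/
noncomputable def centred (ρ : ℝ) (η : S → Bool) (x : S) : ℝ := (if η x then 1 else 0) - ρ

/-- Independence factors the left side over the sites, and Hoeffding's lemma bounds each factor. -/
theorem sum_prodWt_exp_linear_le {ρ : ℝ} (h0 : 0 ≤ ρ) (h1 : ρ ≤ 1) (t : S → ℝ) :
    ∑ η : S → Bool, prodWt ρ η * Real.exp (∑ x, t x * centred ρ η x)
      ≤ Real.exp ((∑ x, t x ^ 2) / 8) := by
  have := sum_prodWt_mul_prod ρ (fun (x : S) s => Real.exp (t x * ((if s then 1 else 0) - ρ)))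
  simp only [Real.exp_sum, centred]
  rw [this, Finset.sum_div, Real.exp_sum]
  refine Finset.prod_le_prod (fun x _ => ?_) (fun x _ => ?_)
  · have := sub_nonneg.2 h1
    positivity
  · simpa using bernoulli_mgf_le h0 h1 (t x)

/-- Exponential moments of a quadratic form, given by its spectral decomposition, under a product
of Bernoulli laws. -/
theorem sum_prodWt_exp_quadratic_le {ρ : ℝ} (h0 : 0 ≤ ρ) (h1 : ρ ≤ 1) {ι : Type*} [Fintype ι]
    [DecidableEq ι] (α : ι → ℝ) (hα0 : ∀ k, 0 ≤ α k) (hα1 : ∀ k, α k ≤ 1) (v : ι → S → ℝ)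
    (hv : ∀ k l, ∑ x, v k x * v l x = if k = l then 1 else 0) :
    ∑ η : S → Bool, prodWt ρ η * Real.exp (∑ k, α k * (∑ x, v k x * centred ρ η x) ^ 2)
      ≤ Real.exp (∑ k, α k) := by
  let Γ : Measure (ι → ℝ) := Measure.pi fun _ => gaussianReal 0 1
  let s : (S → Bool) → ι → ℝ := fun η k => ∑ x, v k x * centred ρ η x
  -- Hubbard–Stratonovich: each squared linear form in the exponent is replaced by a linear one
  -- coupled to an independent standard Gaussian.
  have hexp : ∀ η : S → Bool, Real.exp (∑ k, α k * (s η k) ^ 2)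
      = ∫ g, ∏ k, Real.exp (√(2 * α k) * s η k * g k) ∂Γ := by
    intro η
    rw [integral_fintype_prod_eq_prod (𝕜 := ℝ)
      (fun k (y : ℝ) => Real.exp (√(2 * α k) * s η k * y)), Real.exp_sum]
    refine Finset.prod_congr rfl fun k _ => ?_
    rw [integral_exp_mul_gaussianReal, mul_pow, Real.sq_sqrt (by linarith [hα0 k])]
    congr 1; ring
  have hintg : ∀ η : S → Bool,
      Integrable (fun g : ι → ℝ => ∏ k, Real.exp (√(2 * α k) * s η k * g k)) Γ := by
    intro η
    refine Integrable.of_integral_ne_zero ?_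
    rw [← hexp η]
    exact (Real.exp_pos _).ne'
  have hpt : ∀ g : ι → ℝ, ∑ η : S → Bool, prodWt ρ η * ∏ k, Real.exp (√(2 * α k) * s η k * g k)
      ≤ ∏ k, Real.exp (α k / 4 * g k ^ 2) := by
    intro g
    let t : S → ℝ := fun x => ∑ k, √(2 * α k) * g k * v k x
    have e1 : ∀ η : S → Bool, ∏ k, Real.exp (√(2 * α k) * s η k * g k)
        = Real.exp (∑ x, t x * centred ρ η x) := by
      intro η
      rw [← Real.exp_sum]
      congr 1
      simp only [s, t, Finset.mul_sum, Finset.sum_mul]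
      rw [Finset.sum_comm]
      exact Finset.sum_congr rfl fun x _ => Finset.sum_congr rfl fun k _ => by ring
    -- Orthonormality diagonalizes the sum of squares. The constant 1/8 from Hoeffding's lemma turns
    -- `2α` into `α / 4`, below the threshold 1/2 for Gaussian integrability.
    have e2 : (∑ x, t x ^ 2) / 8 = ∑ k, α k / 4 * g k ^ 2 := by
      have : ∑ x, t x ^ 2 = ∑ k, 2 * α k * g k ^ 2 := by
        have h : ∀ x, t x ^ 2 = ∑ k, ∑ l, (√(2 * α k) * g k) * (√(2 * α l) * g l)
            * (v k x * v l x) := by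
          intro x
          rw [sq, Finset.sum_mul_sum]
          exact Finset.sum_congr rfl fun k _ => Finset.sum_congr rfl fun l _ => by ring
        simp only [h]
        rw [Finset.sum_comm]
        refine Finset.sum_congr rfl fun k _ => ?_
        rw [Finset.sum_comm]
        simp only [← Finset.mul_sum, hv]
        simp only [mul_ite, mul_one, mul_zero, Finset.sum_ite_eq, Finset.mem_univ, if_true]
        have := Real.mul_self_sqrt (show 0 ≤ 2 * α k by linarith [hα0 k])
        linear_combination g k ^ 2 * this
      rw [this, Finset.sum_div]
      exact Finset.sum_congr rfl fun k _ => by ring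
    simp only [e1]
    rw [← Real.exp_sum, ← e2]
    exact sum_prodWt_exp_linear_le h0 h1 t
  have hc : ∀ k, α k / 4 < 1 / 2 := fun k => by linarith [hα1 k]
  calc ∑ η : S → Bool, prodWt ρ η * Real.exp (∑ k, α k * (s η k) ^ 2)
      = ∫ g, ∑ η : S → Bool, prodWt ρ η * ∏ k, Real.exp (√(2 * α k) * s η k * g k) ∂Γ := by
        rw [integral_finsetSum _ fun η _ => (hintg η).const_mul _]
        exact Finset.sum_congr rfl fun η _ => by rw [integral_const_mul, hexp]
    _ ≤ ∫ g, ∏ k, Real.exp (α k / 4 * g k ^ 2) ∂Γ := by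
        refine integral_mono (integrable_finsetSum _ fun η _ => (hintg η).const_mul _) ?_ hpt
        exact Integrable.fintype_prod (𝕜 := ℝ) (f := fun k y => Real.exp (α k / 4 * y ^ 2))
          fun k => integrable_exp_mul_sq_gaussianReal (hc k)
    _ = ∏ k, ∫ y, Real.exp (α k / 4 * y ^ 2) ∂(gaussianReal 0 1) :=
        integral_fintype_prod_eq_prod (𝕜 := ℝ) (fun k (y : ℝ) => Real.exp (α k / 4 * y ^ 2))
    _ ≤ ∏ k, Real.exp (α k) := by
        refine Finset.prod_le_prod (fun k _ => integral_nonneg fun y => (Real.exp_pos _).le)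
          fun k _ => ?_
        have := integral_exp_mul_sq_gaussianReal_le (c := α k / 4) (by linarith [hα0 k])
          (by linarith [hα1 k])
        rwa [mul_div_cancel₀ _ (four_ne_zero)] at this
    _ = Real.exp (∑ k, α k) := (Real.exp_sum _ _).symm

end Gaussian

/-! ### Discrete calculus on the torus. -/

section Lattice

variable {d n : ℕ} [NeZero n]

/-- The unit vector in direction `j`. -/
def unitVec (j : Fin d) : Torus d n := Pi.single j 1

/-- The forward difference in direction `j`. -/
def grad (j : Fin d) (u : Torus d n → ℝ) (x : Torus d n) : ℝ := u (x + unitVec j) - u x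

/-- The sum over the `2 d` nearest neighbours. -/
def adjOp (u : Torus d n → ℝ) (x : Torus d n) : ℝ :=
  ∑ j : Fin d, (u (x + unitVec j) + u (x - unitVec j))

/-- The operator `1 - n² Δ`. -/
def massiveOp (u : Torus d n → ℝ) (x : Torus d n) : ℝ :=
  u x + (n : ℝ) ^ 2 * (2 * d * u x - adjOp u x)

theorem sum_add_right_eq (F : Torus d n → ℝ) (e : Torus d n) :
    ∑ x, F (x + e) = ∑ x, F x := Equiv.sum_comp (Equiv.addRight e) F

theorem sum_sub_right_eq (F : Torus d n → ℝ) (e : Torus d n) :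
    ∑ x, F (x - e) = ∑ x, F x := Equiv.sum_comp (Equiv.subRight e) F

omit [NeZero n] in
theorem grad_adjOp (j : Fin d) (u : Torus d n → ℝ) : grad j (adjOp u) = adjOp (grad j u) := by
  funext x
  simp only [grad, adjOp, ← Finset.sum_sub_distrib]
  refine Finset.sum_congr rfl fun i _ => ?_
  rw [show x + unitVec j + unitVec i = x + unitVec i + unitVec j by abel,
    show x + unitVec j - unitVec i = x - unitVec i + unitVec j by abel]
  ring

omit [NeZero n] in
theorem adjOp_massiveOp (u : Torus d n → ℝ) : adjOp (massiveOp u) = massiveOp (adjOp u) := by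
  have h : ∀ (v w : Torus d n → ℝ) (a b : ℝ) (x : Torus d n),
      adjOp (fun y => v y + a * (b * v y - w y)) x
        = adjOp v x + a * (b * adjOp v x - adjOp w x) := by
    intro v w a b x
    simp only [adjOp, Finset.mul_sum, ← Finset.sum_sub_distrib, ← Finset.sum_add_distrib]
    exact Finset.sum_congr rfl fun j _ => by ring
  funext x
  exact h u (adjOp u) _ _ x

/-- Summation by parts; translation invariance of the sum leaves no boundary term. -/
theorem sum_mul_laplacian (u v : Torus d n → ℝ) :
    ∑ x, u x * (2 * d * v x - adjOp v x) = ∑ j : Fin d, ∑ x, grad j u x * grad j v x := by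
  have h : ∀ j : Fin d, ∑ x, grad j u x * grad j v x
      = ∑ x, (2 * (u x * v x) - u x * (v (x + unitVec j) + v (x - unitVec j))) := by
    intro j
    have e1 := sum_add_right_eq (fun x => u x * v x) (unitVec j)
    have e2 := sum_add_right_eq (fun x => u x * v (x - unitVec j)) (unitVec j)
    simp only [add_sub_cancel_right] at e2
    simp only [grad, sub_mul, mul_sub, mul_add, Finset.sum_sub_distrib, Finset.sum_add_distrib,
      ← Finset.mul_sum, e1]
    rw [e2]; ring
  simp only [h]
  rw [Finset.sum_comm]
  refine Finset.sum_congr rfl fun x _ => ?_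
  simp only [adjOp, Finset.sum_sub_distrib, ← Finset.mul_sum, Finset.sum_const, Finset.card_univ,
    Fintype.card_fin, nsmul_eq_mul]
  ring

theorem abs_sum_mul_adjOp_le (u : Torus d n → ℝ) :
    |∑ x, u x * adjOp u x| ≤ 2 * d * ∑ x, u x ^ 2 := by
  have h : ∀ j : Fin d, ∑ x, (u x ^ 2 + u (x + unitVec j) ^ 2 / 2 + u (x - unitVec j) ^ 2 / 2)
      = 2 * ∑ x, u x ^ 2 := by
    intro j
    simp only [Finset.sum_add_distrib, ← Finset.sum_div]
    rw [sum_add_right_eq (fun x => u x ^ 2), sum_sub_right_eq (fun x => u x ^ 2)]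
    ring
  calc |∑ x, u x * adjOp u x|
      ≤ ∑ x, |u x * adjOp u x| := Finset.abs_sum_le_sum_abs _ _
    _ ≤ ∑ x, ∑ j : Fin d, (u x ^ 2 + u (x + unitVec j) ^ 2 / 2 + u (x - unitVec j) ^ 2 / 2) := by
        refine Finset.sum_le_sum fun x _ => ?_
        rw [adjOp, Finset.mul_sum]
        refine (Finset.abs_sum_le_sum_abs _ _).trans (Finset.sum_le_sum fun j _ => ?_)
        rw [abs_le]
        constructor <;>
        nlinarith [sq_nonneg (u x + u (x + unitVec j)), sq_nonneg (u x - u (x + unitVec j)),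
          sq_nonneg (u x + u (x - unitVec j)), sq_nonneg (u x - u (x - unitVec j))]
    _ = 2 * d * ∑ x, u x ^ 2 := by
        rw [Finset.sum_comm]
        simp only [h, Finset.sum_const, Finset.card_univ, Fintype.card_fin, nsmul_eq_mul]
        ring

theorem sum_adjOp_sq_le (u : Torus d n → ℝ) :
    ∑ x, adjOp u x ^ 2 ≤ 4 * (d : ℝ) ^ 2 * ∑ x, u x ^ 2 := by
  calc ∑ x, adjOp u x ^ 2
      ≤ ∑ x, (d : ℝ) * ∑ j : Fin d, (2 * u (x + unitVec j) ^ 2 + 2 * u (x - unitVec j) ^ 2) := by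
        refine Finset.sum_le_sum fun x _ => ?_
        have := sq_sum_le_card_mul_sum_sq (s := (Finset.univ : Finset (Fin d)))
          (f := fun j => u (x + unitVec j) + u (x - unitVec j))
        rw [Finset.card_univ, Fintype.card_fin] at this
        refine this.trans (mul_le_mul_of_nonneg_left ?_ (Nat.cast_nonneg d))
        refine Finset.sum_le_sum fun j _ => ?_
        nlinarith [sq_nonneg (u (x + unitVec j) - u (x - unitVec j))]
    _ = 4 * (d : ℝ) ^ 2 * ∑ x, u x ^ 2 := by
        rw [← Finset.mul_sum, Finset.sum_comm]
        simp only [Finset.sum_add_distrib, ← Finset.mul_sum]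
        simp only [sum_add_right_eq (fun x => u x ^ 2), sum_sub_right_eq (fun x => u x ^ 2),
          Finset.sum_const, Finset.card_univ, Fintype.card_fin, nsmul_eq_mul]
        ring

end Lattice

/-! ### The Green function and its quadratic form. -/

section Green

variable {d n : ℕ} [NeZero n]

/-- The real part of the standard additive character of `ZMod n`. -/
noncomputable def cosChar (t : ZMod n) : ℝ := (ZMod.stdAddChar t).re

@[simp] theorem cosChar_zero : cosChar (0 : ZMod n) = 1 := by simp [cosChar]

theorem cosChar_neg (t : ZMod n) : cosChar (-t) = cosChar t := by
  simp [cosChar, AddChar.map_neg_eq_conj]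

theorem abs_cosChar_le (t : ZMod n) : |cosChar t| ≤ 1 := by
  refine (Complex.abs_re_le_norm _).trans ?_
  rw [AddChar.norm_apply]

theorem cosChar_add_add_cosChar_sub (t s : ZMod n) :
    cosChar (t + s) + cosChar (t - s) = 2 * cosChar t * cosChar s := by
  simp only [cosChar, sub_eq_add_neg, AddChar.map_add_eq_mul, AddChar.map_neg_eq_conj,
    Complex.mul_re, Complex.conj_re, Complex.conj_im]
  ring

theorem sum_cosChar (x : Torus d n) :
    ∑ m : Torus d n, cosChar (∑ j, m j * x j) = if x = 0 then (n : ℝ) ^ d else 0 := by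
  have h : ∑ m : Torus d n, ZMod.stdAddChar (∑ j, m j * x j)
      = if x = 0 then (n : ℂ) ^ d else 0 := by
    have h1 : ∀ m : Torus d n, ZMod.stdAddChar (∑ j, m j * x j)
        = ∏ j, ZMod.stdAddChar (m j * x j) := fun m =>
      map_prod (ZMod.stdAddChar (N := n)).toMonoidHom
        (fun j => Multiplicative.ofAdd (m j * x j)) Finset.univ
    simp only [h1]
    rw [← Fintype.piFinset_univ, ← Finset.prod_univ_sum (fun _ : Fin d => Finset.univ)
      (fun j (t : ZMod n) => ZMod.stdAddChar (t * x j))]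
    simp only [AddChar.sum_mulShift _ (ZMod.isPrimitive_stdAddChar n), ZMod.card]
    split_ifs with hx
    · simp [hx]
    · obtain ⟨j, hj⟩ := Function.ne_iff.1 hx
      exact Finset.prod_eq_zero (Finset.mem_univ j) (by simp at hj; simp [hj])
  have := congrArg Complex.re h
  rw [Complex.re_sum] at this
  simp only [cosChar]
  rw [this]
  split_ifs <;> simp [← Complex.ofReal_natCast, ← Complex.ofReal_pow]

/-- The eigenvalues of minus the discrete Laplacian. -/
noncomputable def lapEig (m : Torus d n) : ℝ := ∑ j, (2 - 2 * cosChar (m j))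

theorem lapEig_nonneg (m : Torus d n) : 0 ≤ lapEig m :=
  Finset.sum_nonneg fun j _ => by linarith [(abs_le.1 (abs_cosChar_le (m j))).2]

/-- The trace of the inverse of `massiveOp`. -/
noncomputable def greenTrace (d n : ℕ) [NeZero n] : ℝ :=
  ∑ m : Torus d n, (1 + (n : ℝ) ^ 2 * lapEig m)⁻¹

/-- The Green function of `massiveOp`. -/
noncomputable def green (x : Torus d n) : ℝ :=
  ((n : ℝ) ^ d)⁻¹ * ∑ m : Torus d n, (1 + (n : ℝ) ^ 2 * lapEig m)⁻¹ * cosChar (∑ j, m j * x j)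

theorem one_le_massive (m : Torus d n) : 1 ≤ 1 + (n : ℝ) ^ 2 * lapEig m := by
  have := lapEig_nonneg m
  have : 0 ≤ (n : ℝ) ^ 2 * lapEig m := by positivity
  linarith

theorem green_neg (x : Torus d n) : green (-x) = green x := by
  unfold green
  congr 1
  refine Finset.sum_congr rfl fun m _ => ?_
  rw [← cosChar_neg]
  simp

/-- Permuting coordinates only relabels the frequencies. This symmetry later makes all lattice
directions equivalent. -/
theorem green_comp (σ : Equiv.Perm (Fin d)) (x : Torus d n) : green (x ∘ σ) = green x := by
  unfold green
  congr 1
  rw [← (Equiv.arrowCongr σ.symm (Equiv.refl (ZMod n))).sum_comp]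
  refine Finset.sum_congr rfl fun m _ => ?_
  have e1 : lapEig ((Equiv.arrowCongr σ.symm (Equiv.refl (ZMod n))) m) = lapEig m := by
    unfold lapEig
    exact Equiv.sum_comp σ (fun j => 2 - 2 * cosChar (m j))
  rw [e1]
  congr 2
  exact Equiv.sum_comp σ (fun j => m j * x j)

theorem green_zero : green (0 : Torus d n) = ((n : ℝ) ^ d)⁻¹ * greenTrace d n := by
  simp [green, greenTrace]

theorem pow_mul_green_zero : (n : ℝ) ^ d * green (0 : Torus d n) = greenTrace d n := by
  have : (n : ℝ) ≠ 0 := Nat.cast_ne_zero.2 (NeZero.ne n)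
  rw [green_zero, mul_inv_cancel_left₀ (pow_ne_zero _ this)]

theorem greenTrace_nonneg : 0 ≤ greenTrace d n :=
  Finset.sum_nonneg fun m _ => by linarith [inv_nonneg.2 (zero_le_one.trans (one_le_massive m))]

theorem abs_green_le (x : Torus d n) : |green x| ≤ green (0 : Torus d n) := by
  rw [green_zero, green, abs_mul, abs_of_nonneg (by positivity : 0 ≤ ((n : ℝ) ^ d)⁻¹)]
  refine mul_le_mul_of_nonneg_left ?_ (by positivity)
  refine (Finset.abs_sum_le_sum_abs _ _).trans (Finset.sum_le_sum fun m _ => ?_)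
  have h := zero_le_one.trans (one_le_massive m)
  rw [abs_mul, abs_of_nonneg (inv_nonneg.2 h)]
  exact mul_le_of_le_one_right (inv_nonneg.2 h) (abs_cosChar_le _)

theorem green_zero_le_one : green (0 : Torus d n) ≤ 1 := by
  have hn : (0 : ℝ) < n := Nat.cast_pos.2 (NeZero.pos n)
  rw [green_zero, inv_mul_le_iff₀ (by positivity), mul_one]
  calc greenTrace d n ≤ ∑ _m : Torus d n, (1 : ℝ) :=
        Finset.sum_le_sum fun m _ => inv_le_one_of_one_le₀ (one_le_massive m)
    _ = (n : ℝ) ^ d := by simp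

/-- Each cosine is an eigenfunction with eigenvalue `1 + n² lapEig m`, which cancels the Fourier
coefficient; orthogonality of characters sums the rest to a delta. -/
theorem massiveOp_green (x : Torus d n) : massiveOp green x = if x = 0 then 1 else 0 := by
  have hn : (n : ℝ) ^ d ≠ 0 := pow_ne_zero _ (Nat.cast_ne_zero.2 (NeZero.ne n))
  have hadj : adjOp green x = ((n : ℝ) ^ d)⁻¹ * ∑ m : Torus d n, (1 + (n : ℝ) ^ 2 * lapEig m)⁻¹
      * ((2 * d - lapEig m) * cosChar (∑ j, m j * x j)) := by
    simp only [adjOp, green, ← mul_add, ← Finset.mul_sum, ← Finset.sum_add_distrib]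
    rw [Finset.sum_comm]
    congr 1
    refine Finset.sum_congr rfl fun m _ => ?_
    rw [← Finset.mul_sum]
    congr 1
    have : ∀ j : Fin d, cosChar (∑ i, m i * (x + unitVec j : Torus d n) i)
        + cosChar (∑ i, m i * (x - unitVec j : Torus d n) i)
        = 2 * cosChar (∑ i, m i * x i) * cosChar (m j) := by
      intro j
      rw [← cosChar_add_add_cosChar_sub]
      simp [unitVec, mul_add, mul_sub, Finset.sum_add_distrib, Finset.sum_sub_distrib,
        Pi.single_apply]
    simp only [this, ← Finset.mul_sum, lapEig, Finset.sum_sub_distrib, Finset.sum_const,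
      Finset.card_univ, Fintype.card_fin, nsmul_eq_mul]
    ring
  have hsum : massiveOp green x = ((n : ℝ) ^ d)⁻¹ * ∑ m : Torus d n, cosChar (∑ j, m j * x j) := by
    rw [massiveOp, hadj, green]
    have : ∀ A B : ℝ, ((n : ℝ) ^ d)⁻¹ * A + (n : ℝ) ^ 2 * (2 * d * (((n : ℝ) ^ d)⁻¹ * A)
        - ((n : ℝ) ^ d)⁻¹ * B)
        = ((n : ℝ) ^ d)⁻¹ * (A + (n : ℝ) ^ 2 * (2 * d * A - B)) := by intros; ring
    rw [this]
    congr 1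
    simp only [Finset.mul_sum, ← Finset.sum_sub_distrib, ← Finset.sum_add_distrib]
    refine Finset.sum_congr rfl fun m _ => ?_
    have h := (zero_lt_one.trans_le (one_le_massive m)).ne'
    field_simp
    ring
  rw [hsum, sum_cosChar]
  split_ifs
  · exact inv_mul_cancel₀ hn
  · simp

/-- Convolution on the torus. -/
def conv (k ω : Torus d n → ℝ) (x : Torus d n) : ℝ := ∑ z, k (x - z) * ω z

theorem adjOp_conv (k ω : Torus d n → ℝ) : adjOp (conv k ω) = conv (adjOp k) ω := by
  funext x
  simp only [adjOp, conv, Finset.sum_mul, ← Finset.sum_add_distrib]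
  rw [Finset.sum_comm]
  refine Finset.sum_congr rfl fun z _ => Finset.sum_congr rfl fun j _ => ?_
  rw [show x + unitVec j - z = x - z + unitVec j by abel,
    show x - unitVec j - z = x - z - unitVec j by abel]
  ring

theorem massiveOp_conv (k ω : Torus d n → ℝ) : massiveOp (conv k ω) = conv (massiveOp k) ω := by
  funext x
  have h := congrFun (adjOp_conv k ω) x
  rw [massiveOp, h]
  simp only [conv, massiveOp, Finset.mul_sum, ← Finset.sum_sub_distrib, ← Finset.sum_add_distrib]
  exact Finset.sum_congr rfl fun z _ => by ring

theorem massiveOp_conv_green (ω : Torus d n → ℝ) : massiveOp (conv green ω) = ω := by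
  funext x
  rw [massiveOp_conv, conv]
  simp [massiveOp_green, sub_eq_zero]

/-- The quadratic form of the inverse of `massiveOp`. -/
noncomputable def greenForm (ω : Torus d n → ℝ) : ℝ := ∑ x, ω x * conv green ω x

theorem sum_massiveOp_mul (u v : Torus d n → ℝ) :
    ∑ x, u x * massiveOp v x = ∑ x, u x * v x
      + (n : ℝ) ^ 2 * ∑ j : Fin d, ∑ x, grad j u x * grad j v x := by
  rw [← sum_mul_laplacian, Finset.mul_sum, ← Finset.sum_add_distrib]
  exact Finset.sum_congr rfl fun x _ => by rw [massiveOp]; ring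

/-- The energy identity for `u = Gω`. It lets `greenForm` control both `u` and `n` times its
gradient. -/
theorem greenForm_eq (ω : Torus d n → ℝ) :
    greenForm ω = ∑ x, conv green ω x ^ 2
      + (n : ℝ) ^ 2 * ∑ j : Fin d, ∑ x, grad j (conv green ω) x ^ 2 := by
  have h := sum_massiveOp_mul (conv green ω) (conv green ω)
  rw [massiveOp_conv_green] at h
  simp only [pow_two (conv green ω _), pow_two (grad _ _ _)]
  rw [← h, greenForm]
  exact Finset.sum_congr rfl fun x _ => mul_comm _ _

theorem greenForm_nonneg (ω : Torus d n → ℝ) : 0 ≤ greenForm ω := by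
  rw [greenForm_eq]; positivity

/-- The spectrum of `G` lies below 1: the energy identity gives `‖u‖² ≤ ⟨ω, u⟩`, and Young's
inequality closes the bound. -/
theorem greenForm_le (ω : Torus d n → ℝ) : greenForm ω ≤ ∑ x, ω x ^ 2 := by
  have h1 : ∑ x, conv green ω x ^ 2 ≤ greenForm ω := by
    rw [greenForm_eq ω]
    have : 0 ≤ (n : ℝ) ^ 2 * ∑ j : Fin d, ∑ x, grad j (conv green ω) x ^ 2 := by positivity
    linarith
  have h2 : greenForm ω ≤ ∑ x, (ω x ^ 2 / 2 + conv green ω x ^ 2 / 2) :=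
    Finset.sum_le_sum fun x _ => by nlinarith [sq_nonneg (ω x - conv green ω x)]
  rw [Finset.sum_add_distrib, ← Finset.sum_div, ← Finset.sum_div] at h2
  linarith

/-- Exponential moments of `greenForm` under the product Bernoulli law. -/
theorem sum_prodWt_exp_greenForm_le {ρ : ℝ} (h0 : 0 ≤ ρ) (h1 : ρ ≤ 1) :
    ∑ η : Torus d n → Bool, prodWt ρ η * Real.exp (greenForm (centred ρ η))
      ≤ Real.exp (greenTrace d n) := by
  let K : Matrix (Torus d n) (Torus d n) ℝ := Matrix.of fun x z => green (x - z)
  have hK : K.IsHermitian := by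
    ext x z
    simp only [K, Matrix.conjTranspose_apply, Matrix.of_apply, star_trivial]
    rw [← green_neg, neg_sub]
  let U := (hK.eigenvectorUnitary : Matrix (Torus d n) (Torus d n) ℝ)
  let v : Torus d n → Torus d n → ℝ := fun k x => U x k
  have horth : ∀ k l, ∑ x, v k x * v l x = if k = l then 1 else 0 := by
    intro k l
    have := Unitary.coe_star_mul_self hK.eigenvectorUnitary
    have := congrFun (congrFun this k) l
    simpa [Matrix.mul_apply, Matrix.one_apply, v, U] using this
  have hspec : ∀ x z, green (x - z) = ∑ k, hK.eigenvalues k * (v k x * v k z) := by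
    intro x z
    have := congrFun (congrFun hK.spectral_theorem x) z
    rw [Unitary.conjStarAlgAut_apply, Matrix.mul_apply] at this
    simp only [K, Matrix.of_apply] at this
    rw [this]
    refine Finset.sum_congr rfl fun k _ => ?_
    rw [Matrix.mul_diagonal]
    simp [v, U]
    ring
  have hform : ∀ ω : Torus d n → ℝ,
      greenForm ω = ∑ k, hK.eigenvalues k * (∑ x, v k x * ω x) ^ 2 := by
    intro ω
    simp only [greenForm, conv, hspec, pow_two, Finset.sum_mul_sum]
    simp only [Finset.mul_sum, Finset.sum_mul]
    rw [Finset.sum_comm' (t' := Finset.univ) (s' := fun _ => Finset.univ) (by simp)]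
    rw [Finset.sum_comm]
    have : ∀ x : Torus d n, ∑ z, ∑ k, ω x * (hK.eigenvalues k * (v k x * v k z) * ω z)
        = ∑ k, ∑ z, ω x * (hK.eigenvalues k * (v k x * v k z) * ω z) :=
      fun x => Finset.sum_comm
    simp only [this]
    rw [Finset.sum_comm]
    exact Finset.sum_congr rfl fun k _ => Finset.sum_congr rfl fun x _ =>
      Finset.sum_congr rfl fun z _ => by ring
  -- Evaluating the form at eigenvectors shows that the eigenvalues lie in `[0, 1]`, as the
  -- exponential moment bound requires.
  have heig : ∀ k, hK.eigenvalues k = greenForm (v k) := by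
    intro k
    rw [hform, Finset.sum_eq_single k]
    · simp [horth]
    · intro l _ hl; simp [horth, hl]
    · simp
  have htr : ∑ k, hK.eigenvalues k = greenTrace d n := by
    have := hK.trace_eq_sum_eigenvalues
    simp only [RCLike.ofReal_real_eq_id, id] at this
    rw [← this, ← pow_mul_green_zero]
    simp [Matrix.trace, K]
  have := sum_prodWt_exp_quadratic_le h0 h1 hK.eigenvalues
    (fun k => by rw [heig]; exact greenForm_nonneg _)
    (fun k => by
      rw [heig]
      refine (greenForm_le _).trans_eq ?_
      simpa [pow_two] using horth k k) v horth
  simp only [← hform, htr] at this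
  exact this

end Green

/-! ### Decomposition of the nearest-neighbour form. -/

section Flux

variable {d n : ℕ} [NeZero n]

omit [NeZero n] in
theorem unitVec_ne_zero (hn : 2 ≤ n) (j : Fin d) : (unitVec j : Torus d n) ≠ 0 := by
  have : Fact (1 < n) := ⟨hn⟩
  intro h
  have := congrFun h j
  simp [unitVec] at this

/-- The difference of `adjOp green` across a bond in direction `j`. -/
noncomputable def bondCoeff (n : ℕ) [NeZero n] (j : Fin d) : ℝ :=
  adjOp green (0 : Torus d n) - adjOp green (unitVec j : Torus d n)

theorem adjOp_green_neg (x : Torus d n) : adjOp green (-x) = adjOp green x := by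
  unfold adjOp
  refine Finset.sum_congr rfl fun j _ => ?_
  rw [← green_neg (-x + unitVec j), ← green_neg (-x - unitVec j), add_comm]
  congr 2 <;> abel

theorem adjOp_green_unitVec (i j : Fin d) :
    adjOp green (unitVec i : Torus d n) = adjOp green (unitVec j : Torus d n) := by
  let σ := Equiv.swap i j
  have hu : ∀ k : Fin d, (unitVec k : Torus d n) ∘ σ = unitVec (σ k) := by
    intro k
    funext l
    simp only [unitVec, Function.comp_apply, Pi.single_apply]
    congr 1
    rw [eq_iff_iff]
    constructor
    · rintro rfl; simp [σ]
    · rintro rfl; simp [σ]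
  unfold adjOp
  rw [← Equiv.sum_comp σ]
  refine Finset.sum_congr rfl fun k _ => ?_
  rw [← green_comp σ (unitVec j + unitVec k), ← green_comp σ (unitVec j - unitVec k)]
  have hj : σ j = i := Equiv.swap_apply_right i j
  have e1 : (unitVec j + unitVec k : Torus d n) ∘ σ = unitVec i + unitVec (σ k) := by
    rw [← hu k, ← hj, ← hu j]; rfl
  have e2 : (unitVec j - unitVec k : Torus d n) ∘ σ = unitVec i - unitVec (σ k) := by
    rw [← hu k, ← hj, ← hu j]; rfl
  rw [e1, e2]

/-- `A G` solves `(1 - n²Δ)(A G) = A δ₀`, whose right side vanishes at the origin when `n ≥ 2`. By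
symmetry all neighbours of the origin carry the same value of `A G`, so the equation at the origin
determines the increment. The gain is a factor `n²` over the trivial bound. -/
theorem two_mul_bondCoeff (hn : 2 ≤ n) (j : Fin d) :
    2 * d * ((n : ℝ) ^ 2 * bondCoeff n j) = -adjOp green (0 : Torus d n) := by
  have h : massiveOp (adjOp green) (0 : Torus d n) = 0 := by
    rw [← adjOp_massiveOp]
    unfold adjOp
    refine Finset.sum_eq_zero fun i _ => ?_
    have := unitVec_ne_zero hn i
    simp [massiveOp_green, this]
  have h2 : adjOp (adjOp green) (0 : Torus d n) = 2 * d * adjOp green (unitVec j : Torus d n) := by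
    rw [adjOp]
    simp only [zero_add, zero_sub, adjOp_green_neg, adjOp_green_unitVec _ j, Finset.sum_const,
      Finset.card_univ, Fintype.card_fin, nsmul_eq_mul]
    ring
  rw [massiveOp, h2] at h
  rw [bondCoeff]
  linarith

theorem abs_bondCoeff_le (hn : 2 ≤ n) (j : Fin d) :
    (n : ℝ) ^ 2 * |bondCoeff n j| ≤ green (0 : Torus d n) := by
  have hd : 0 < (d : ℝ) := Nat.cast_pos.2 (Fin.pos j)
  have h1 : |adjOp green (0 : Torus d n)| ≤ 2 * d * green (0 : Torus d n) := by
    calc |adjOp green (0 : Torus d n)|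
        ≤ ∑ j : Fin d, (green (0 : Torus d n) + green (0 : Torus d n)) :=
          (Finset.abs_sum_le_sum_abs _ _).trans (Finset.sum_le_sum fun i _ =>
            (abs_add_le _ _).trans (add_le_add (abs_green_le _) (abs_green_le _)))
      _ = 2 * d * green (0 : Torus d n) := by simp; ring
  have h2 := congrArg abs (two_mul_bondCoeff hn j)
  rw [abs_neg, abs_mul, abs_mul ((n:ℝ) ^ 2), abs_of_pos (by positivity : (0:ℝ) < 2 * d),
    abs_of_nonneg (by positivity : (0:ℝ) ≤ (n:ℝ) ^ 2)] at h2
  rw [← h2] at h1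
  exact le_of_mul_le_mul_left h1 (by positivity)

/-- The part of the gradient of `adjOp (conv green ω)` across a bond which does not involve the
values of `ω` at the endpoints of the bond. -/
noncomputable def flux (j : Fin d) (ω : Torus d n → ℝ) (x : Torus d n) : ℝ :=
  grad j (adjOp (conv green ω)) x - bondCoeff n j * grad j ω x

/-- In the gradient of `A G ω` across the bond, `ω` has coefficient `-bondCoeff` at `x` and
`bondCoeff` at `x + unitVec j`; subtracting `bondCoeff` times the gradient of `ω` removes both. The
flux is therefore unchanged when the endpoints are exchanged. -/
theorem flux_congr (hn : 2 ≤ n) (j : Fin d) {ω ω' : Torus d n → ℝ} (x : Torus d n)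
    (h : ∀ z, z ≠ x → z ≠ x + unitVec j → ω z = ω' z) : flux j ω x = flux j ω' x := by
  have hne : x ≠ x + unitVec j := by simpa using unitVec_ne_zero hn j
  have key : ∀ w : Torus d n → ℝ, flux j w x
      = ∑ z, (if z = x ∨ z = x + unitVec j then 0 else
        (adjOp green (x + unitVec j - z) - adjOp green (x - z)) * w z) := by
    intro w
    have h1 : grad j w x = ∑ z, ((if z = x + unitVec j then 1 else 0)
        - (if z = x then 1 else 0)) * w z := by
      simp [grad, sub_mul, Finset.sum_sub_distrib]
    rw [flux, h1, adjOp_conv, grad, conv, conv, ← Finset.sum_sub_distrib, Finset.mul_sum,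
      ← Finset.sum_sub_distrib]
    refine Finset.sum_congr rfl fun z _ => ?_
    by_cases hz1 : z = x
    · subst hz1
      simp [hne, bondCoeff]
      ring
    · by_cases hz2 : z = x + unitVec j
      · subst hz2
        simp [hne.symm, bondCoeff, adjOp_green_neg]
        ring
      · simp [hz1, hz2]; ring
  rw [key, key]
  refine Finset.sum_congr rfl fun z _ => ?_
  split_ifs with hz
  · rfl
  · push Not at hz
    rw [h z hz.1 hz.2]

/-- With `ω = (1 - n²Δ)u`, and since `A` commutes with gradients, the sum equals `⟨u, Au⟩ + n² ∑
⟨∇u, A∇u⟩`. The quadratic form of `A` is bounded by `2d`, which leaves the energy of `u`. -/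
theorem abs_sum_mul_adjOp_conv_green_le (ω : Torus d n → ℝ) :
    |∑ x, ω x * adjOp (conv green ω) x| ≤ 2 * d * greenForm ω := by
  set u := conv green ω with hu
  have h1 : ∑ x, ω x * adjOp u x = ∑ x, u x * adjOp u x
      + (n : ℝ) ^ 2 * ∑ j : Fin d, ∑ x, grad j u x * adjOp (grad j u) x := by
    have h := sum_massiveOp_mul (adjOp u) u
    rw [hu, massiveOp_conv_green, ← hu] at h
    simp only [grad_adjOp] at h
    simp only [mul_comm (ω _), mul_comm (u _), mul_comm (grad _ u _)]
    exact h
  rw [h1, greenForm_eq, ← hu]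
  refine (abs_add_le _ _).trans ?_
  rw [abs_mul, abs_of_nonneg (by positivity : (0:ℝ) ≤ (n:ℝ) ^ 2)]
  have h2 := abs_sum_mul_adjOp_le u
  have h3 : |∑ j : Fin d, ∑ x, grad j u x * adjOp (grad j u) x|
      ≤ 2 * d * ∑ j : Fin d, ∑ x, grad j u x ^ 2 := by
    rw [Finset.mul_sum]
    exact (Finset.abs_sum_le_sum_abs _ _).trans
      (Finset.sum_le_sum fun j _ => abs_sum_mul_adjOp_le _)
  have h4 := mul_le_mul_of_nonneg_left h3 (by positivity : (0:ℝ) ≤ (n:ℝ) ^ 2)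
  linarith

/-- Decomposition of the nearest-neighbour quadratic form into a bounded multiple of `greenForm`,
a gradient term and a term without fluctuations. -/
theorem sum_mul_adjOp_eq (ω : Torus d n → ℝ) :
    ∑ x, ω x * adjOp ω x = ∑ x, ω x * adjOp (conv green ω) x
      + (n : ℝ) ^ 2 * ∑ j : Fin d, ∑ x, grad j ω x * flux j ω x
      + (n : ℝ) ^ 2 * ∑ j : Fin d, ∑ x, bondCoeff n j * grad j ω x ^ 2 := by
  have h := sum_massiveOp_mul ω (adjOp (conv green ω))
  rw [← adjOp_massiveOp, massiveOp_conv_green] at h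
  rw [h, add_assoc, ← mul_add, ← Finset.sum_add_distrib]
  congr 2
  refine Finset.sum_congr rfl fun j _ => ?_
  rw [← Finset.sum_add_distrib]
  exact Finset.sum_congr rfl fun x _ => by rw [flux]; ring

theorem abs_bondCoeff_term_le (hn : 2 ≤ n) (ω : Torus d n → ℝ)
    (hω : ∀ j x, grad j ω x ^ 2 ≤ 1) :
    |(n : ℝ) ^ 2 * ∑ j : Fin d, ∑ x, bondCoeff n j * grad j ω x ^ 2| ≤ d * greenTrace d n := by
  rw [Finset.mul_sum]
  calc |∑ j : Fin d, (n : ℝ) ^ 2 * ∑ x, bondCoeff n j * grad j ω x ^ 2|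
      ≤ ∑ j : Fin d, ∑ _x : Torus d n, green (0 : Torus d n) := by
        refine (Finset.abs_sum_le_sum_abs _ _).trans (Finset.sum_le_sum fun j _ => ?_)
        rw [Finset.mul_sum]
        refine (Finset.abs_sum_le_sum_abs _ _).trans (Finset.sum_le_sum fun x _ => ?_)
        rw [abs_mul, abs_mul, ← mul_assoc, abs_of_nonneg (sq_nonneg (grad j ω x)),
          abs_of_nonneg (by positivity : (0:ℝ) ≤ (n:ℝ) ^ 2)]
        exact (mul_le_of_le_one_right (by positivity) (hω j x)).trans (abs_bondCoeff_le hn j)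
    _ = d * greenTrace d n := by
        rw [← pow_mul_green_zero]; simp

/-- The flux is `A∇u` minus a bond correction. The first part is bounded by the energy of `u`
because `A` is bounded; the second contributes at most `G(0)` per bond, hence a multiple of the
trace. -/
theorem sum_flux_sq_le (hn : 2 ≤ n) (ω : Torus d n → ℝ) (hω : ∀ j x, grad j ω x ^ 2 ≤ 1) :
    (n : ℝ) ^ 2 * ∑ j : Fin d, ∑ x, flux j ω x ^ 2
      ≤ 8 * (d : ℝ) ^ 2 * greenForm ω + 2 * d * greenTrace d n := by
  set u := conv green ω with hu
  have hn1 : (1 : ℝ) ≤ (n : ℝ) ^ 2 := by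
    have : (1 : ℝ) ≤ n := by exact_mod_cast (by omega : 1 ≤ n)
    exact one_le_pow₀ this
  have hg0 : 0 ≤ green (0 : Torus d n) := (abs_nonneg _).trans (abs_green_le 0)
  have hb : ∀ j : Fin d, (n : ℝ) ^ 2 * bondCoeff n j ^ 2 ≤ green (0 : Torus d n) := by
    intro j
    have h1 := abs_bondCoeff_le hn j
    -- This allows `n² bondCoeff²` to be bounded by `n² |bondCoeff|`, and so by `G(0)`.
    have h2 : |bondCoeff n j| ≤ 1 := by
      nlinarith [green_zero_le_one (d := d) (n := n), abs_nonneg (bondCoeff n j)]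
    rw [← sq_abs (bondCoeff n j)]
    nlinarith [abs_nonneg (bondCoeff n j), mul_nonneg (sq_nonneg (n:ℝ)) (abs_nonneg (bondCoeff n j))]
  have hpt : ∀ (j : Fin d) x, (n : ℝ) ^ 2 * flux j ω x ^ 2
      ≤ 2 * ((n : ℝ) ^ 2 * adjOp (grad j u) x ^ 2) + 2 * green (0 : Torus d n) := by
    intro j x
    rw [flux, ← hu, grad_adjOp]
    have h1 : (bondCoeff n j * grad j ω x) ^ 2 ≤ bondCoeff n j ^ 2 := by
      rw [mul_pow]
      exact mul_le_of_le_one_right (sq_nonneg _) (hω j x)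
    have h2 : (adjOp (grad j u) x - bondCoeff n j * grad j ω x) ^ 2
        ≤ 2 * adjOp (grad j u) x ^ 2 + 2 * bondCoeff n j ^ 2 := by
      nlinarith [sq_nonneg (adjOp (grad j u) x + bondCoeff n j * grad j ω x)]
    have h3 := mul_le_mul_of_nonneg_left h2 (by positivity : (0:ℝ) ≤ (n:ℝ) ^ 2)
    linarith [hb j]
  calc (n : ℝ) ^ 2 * ∑ j : Fin d, ∑ x, flux j ω x ^ 2
      = ∑ j : Fin d, ∑ x, (n : ℝ) ^ 2 * flux j ω x ^ 2 := by simp only [Finset.mul_sum]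
    _ ≤ ∑ j : Fin d, ∑ x, (2 * ((n : ℝ) ^ 2 * adjOp (grad j u) x ^ 2)
          + 2 * green (0 : Torus d n)) :=
        Finset.sum_le_sum fun j _ => Finset.sum_le_sum fun x _ => hpt j x
    _ = 2 * ((n : ℝ) ^ 2 * ∑ j : Fin d, ∑ x, adjOp (grad j u) x ^ 2)
          + 2 * d * greenTrace d n := by
        rw [← pow_mul_green_zero]
        simp only [Finset.sum_add_distrib, ← Finset.mul_sum]
        simp
        ring
    _ ≤ 2 * ((n : ℝ) ^ 2 * ∑ j : Fin d, 4 * (d : ℝ) ^ 2 * ∑ x, grad j u x ^ 2)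
          + 2 * d * greenTrace d n := by
        gcongr with j _
        exact sum_adjOp_sq_le _
    _ ≤ 8 * (d : ℝ) ^ 2 * greenForm ω + 2 * d * greenTrace d n := by
        rw [greenForm_eq, ← hu, ← Finset.mul_sum]
        have : 0 ≤ 8 * (d : ℝ) ^ 2 * ∑ x, u x ^ 2 := by positivity
        linarith

end Flux

/-! ### Growth of the trace of the Green operator. -/

section Trace

variable {d n : ℕ} [NeZero n]

/-- The quadratic bound `cos θ ≤ 1 - 2θ²/π²` is available because the centred representative puts
the angle in `[-π, π]`. It even yields the factor 16, which is discarded. -/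
theorem valMinAbs_sq_le (t : ZMod n) :
    (t.valMinAbs : ℝ) ^ 2 ≤ (n : ℝ) ^ 2 * (2 - 2 * cosChar t) := by
  have hn : (0 : ℝ) < n := Nat.cast_pos.2 (NeZero.pos n)
  have hcos : cosChar t = Real.cos (2 * Real.pi * t.valMinAbs / n) := by
    have h := ZMod.stdAddChar_coe (N := n) t.valMinAbs
    rw [ZMod.coe_valMinAbs] at h
    rw [cosChar, h, ← Complex.exp_ofReal_mul_I_re]
    congr 2
    push_cast
    ring
  have hv : |(t.valMinAbs : ℝ)| ≤ n / 2 := by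
    have h1 : t.valMinAbs.natAbs ≤ n / 2 := ZMod.natAbs_valMinAbs_le t
    have h2 : (t.valMinAbs.natAbs : ℝ) ≤ n / 2 := by
      rw [le_div_iff₀ two_pos]
      exact_mod_cast (by omega : t.valMinAbs.natAbs * 2 ≤ n)
    rwa [Nat.cast_natAbs, Int.cast_abs] at h2
  have hπ := Real.pi_pos
  have hle : |2 * Real.pi * t.valMinAbs / n| ≤ Real.pi := by
    rw [abs_div, abs_mul, abs_of_pos (by positivity : 0 < 2 * Real.pi), abs_of_pos hn,
      div_le_iff₀ hn]
    nlinarith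
  have h := Real.cos_le_one_sub_mul_cos_sq hle
  have e : (n : ℝ) ^ 2 * (2 / Real.pi ^ 2 * (2 * Real.pi * t.valMinAbs / n) ^ 2)
      = 8 * (t.valMinAbs : ℝ) ^ 2 := by
    field_simp
    ring
  rw [hcos]
  nlinarith [mul_le_mul_of_nonneg_left h (sq_nonneg (n : ℝ)), sq_nonneg (t.valMinAbs : ℝ)]

theorem card_ball_le (k : ℕ) :
    (Finset.univ.filter fun s : ZMod n => s.valMinAbs.natAbs ≤ k).card ≤ 2 * k + 1 := by
  have h : ((Finset.univ.filter fun s : ZMod n => s.valMinAbs.natAbs ≤ k).image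
      ZMod.valMinAbs) ⊆ Finset.Icc (-(k : ℤ)) k := by
    intro z hz
    simp only [Finset.mem_image, Finset.mem_filter, Finset.mem_univ, true_and] at hz
    obtain ⟨s, hs, rfl⟩ := hz
    rw [Finset.mem_Icc]
    omega
  have h2 := Finset.card_le_card h
  rw [Finset.card_image_of_injective _ (ZMod.injective_valMinAbs), Int.card_Icc] at h2
  omega

theorem card_sphere_le (k : ℕ) :
    (Finset.univ.filter fun s : ZMod n => s.valMinAbs.natAbs = k).card ≤ 2 := by
  have h : ((Finset.univ.filter fun s : ZMod n => s.valMinAbs.natAbs = k).image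
      ZMod.valMinAbs) ⊆ {(k : ℤ), -(k : ℤ)} := by
    intro z hz
    simp only [Finset.mem_image, Finset.mem_filter, Finset.mem_univ, true_and] at hz
    obtain ⟨s, hs, rfl⟩ := hz
    simp only [Finset.mem_insert, Finset.mem_singleton]
    omega
  have h2 := Finset.card_le_card h
  rw [Finset.card_image_of_injective _ (ZMod.injective_valMinAbs)] at h2
  exact h2.trans Finset.card_le_two

theorem card_dominated_le (j : Fin d) (t : ZMod n) :
    (Finset.univ.filter fun m : Torus d n =>
      m j = t ∧ ∀ i, (m i).valMinAbs.natAbs ≤ t.valMinAbs.natAbs).card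
      ≤ (2 * t.valMinAbs.natAbs + 1) ^ (d - 1) := by
  let B : Fin d → Finset (ZMod n) := fun i => if i = j then {t} else
    Finset.univ.filter fun s : ZMod n => s.valMinAbs.natAbs ≤ t.valMinAbs.natAbs
  have h : (Finset.univ.filter fun m : Torus d n =>
      m j = t ∧ ∀ i, (m i).valMinAbs.natAbs ≤ t.valMinAbs.natAbs) ⊆ Fintype.piFinset B := by
    intro m hm
    simp only [Finset.mem_filter, Finset.mem_univ, true_and] at hm
    rw [Fintype.mem_piFinset]
    intro i
    simp only [B]
    split_ifs with hi
    · rw [hi, hm.1]; simp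
    · simpa using hm.2 i
  refine (Finset.card_le_card h).trans ?_
  rw [Fintype.card_piFinset, ← Finset.mul_prod_erase _ _ (Finset.mem_univ j)]
  have h1 : (B j).card = 1 := by simp [B]
  rw [h1, one_mul]
  refine (Finset.prod_le_pow_card _ _ (2 * t.valMinAbs.natAbs + 1) fun i hi => ?_).trans_eq ?_
  · simp only [B, if_neg (Finset.ne_of_mem_erase hi)]
    exact card_ball_le _
  · simp

/-- Each frequency is assigned to a coordinate of largest absolute value `k`. That coordinate alone
bounds the eigenvalue from below; at most two residues have absolute value `k`, and the other
coordinates have at most `(2k + 1)^(d - 1)` choices. -/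
theorem greenTrace_le_sum (hd : 1 ≤ d) :
    greenTrace d n ≤ d * ∑ k ∈ Finset.range n,
      2 * ((2 * (k : ℝ) + 1) ^ (d - 1) * (1 + (k : ℝ) ^ 2)⁻¹) := by
  have : Nonempty (Fin d) := ⟨⟨0, hd⟩⟩
  let a : ZMod n → ℕ := fun t => t.valMinAbs.natAbs
  have ha : ∀ t : ZMod n, ((t.valMinAbs : ℝ)) ^ 2 = (a t : ℝ) ^ 2 := fun t => by
    simp [a, Nat.cast_natAbs]
  have hpt : ∀ m : Torus d n, (1 + (n : ℝ) ^ 2 * lapEig m)⁻¹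
      ≤ ∑ j : Fin d, if (∀ i, a (m i) ≤ a (m j)) then (1 + (a (m j) : ℝ) ^ 2)⁻¹ else 0 := by
    intro m
    obtain ⟨j, hj⟩ := Finite.exists_max fun i => a (m i)
    refine le_trans ?_ (Finset.single_le_sum (f := fun j : Fin d =>
      if (∀ i, a (m i) ≤ a (m j)) then (1 + (a (m j) : ℝ) ^ 2)⁻¹ else 0)
      (fun i _ => by positivity) (Finset.mem_univ j))
    simp only [if_pos hj]
    refine inv_anti₀ (by positivity) ?_
    rw [lapEig, Finset.mul_sum, ← ha]
    have h1 := Finset.single_le_sum (f := fun i : Fin d => (n : ℝ) ^ 2 * (2 - 2 * cosChar (m i)))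
      (fun i _ => (sq_nonneg _).trans (valMinAbs_sq_le (m i))) (Finset.mem_univ j)
    linarith [valMinAbs_sq_le (m j)]
  have hdir : ∀ j : Fin d, (∑ m : Torus d n,
      if (∀ i, a (m i) ≤ a (m j)) then (1 + (a (m j) : ℝ) ^ 2)⁻¹ else 0)
      ≤ ∑ t : ZMod n, (2 * (a t : ℝ) + 1) ^ (d - 1) * (1 + (a t : ℝ) ^ 2)⁻¹ := by
    intro j
    rw [← Finset.sum_fiberwise Finset.univ (fun m : Torus d n => m j)]
    refine Finset.sum_le_sum fun t _ => ?_
    have : ∀ m ∈ Finset.univ.filter (fun m : Torus d n => m j = t),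
        (if (∀ i, a (m i) ≤ a (m j)) then (1 + (a (m j) : ℝ) ^ 2)⁻¹ else 0)
        = if (∀ i, a (m i) ≤ a t) then (1 + (a t : ℝ) ^ 2)⁻¹ else 0 := by
      intro m hm
      rw [(Finset.mem_filter.1 hm).2]
    rw [Finset.sum_congr rfl this, ← Finset.sum_filter, Finset.filter_filter, Finset.sum_const,
      nsmul_eq_mul]
    refine mul_le_mul_of_nonneg_right ?_ (by positivity)
    exact_mod_cast card_dominated_le j t
  have hfib : ∀ g : ℕ → ℝ, (∀ k, 0 ≤ g k) → ∑ t : ZMod n, g (a t) ≤ ∑ k ∈ Finset.range n, 2 * g k := by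
    intro g hg
    have hmaps : ∀ t ∈ (Finset.univ : Finset (ZMod n)), a t ∈ Finset.range n := by
      intro t _
      have := ZMod.natAbs_valMinAbs_le t
      have := NeZero.pos n
      simp only [Finset.mem_range, a]
      omega
    rw [← Finset.sum_fiberwise_of_maps_to hmaps]
    refine Finset.sum_le_sum fun k _ => ?_
    rw [Finset.sum_congr rfl (g := fun _ => g k) fun t ht => by rw [(Finset.mem_filter.1 ht).2],
      Finset.sum_const, nsmul_eq_mul]
    exact mul_le_mul_of_nonneg_right (by exact_mod_cast card_sphere_le k) (hg k)
  calc greenTrace d n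
      ≤ ∑ m : Torus d n, ∑ j : Fin d,
        if (∀ i, a (m i) ≤ a (m j)) then (1 + (a (m j) : ℝ) ^ 2)⁻¹ else 0 :=
        Finset.sum_le_sum fun m _ => hpt m
    _ = ∑ j : Fin d, ∑ m : Torus d n,
        if (∀ i, a (m i) ≤ a (m j)) then (1 + (a (m j) : ℝ) ^ 2)⁻¹ else 0 := Finset.sum_comm
    _ ≤ ∑ j : Fin d, ∑ k ∈ Finset.range n,
        2 * ((2 * (k : ℝ) + 1) ^ (d - 1) * (1 + (k : ℝ) ^ 2)⁻¹) :=
        Finset.sum_le_sum fun j _ => (hdir j).trans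
          (hfib (fun k => (2 * (k : ℝ) + 1) ^ (d - 1) * (1 + (k : ℝ) ^ 2)⁻¹)
            fun k => by positivity)
    _ = _ := by simp

theorem shell_term_le (d k : ℕ) (hd : 1 ≤ d) :
    (2 * (k : ℝ) + 1) ^ (d - 1) * (1 + (k : ℝ) ^ 2)⁻¹ ≤ 2 ^ d * ((k : ℝ) + 1) ^ ((d : ℤ) - 3) := by
  have hk : (0 : ℝ) < (k : ℝ) + 1 := by positivity
  have h1 : (2 * (k : ℝ) + 1) ^ (d - 1) ≤ 2 ^ (d - 1) * ((k : ℝ) + 1) ^ (d - 1) := by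
    rw [← mul_pow]
    exact pow_le_pow_left₀ (by positivity) (by linarith) _
  have h2 : (1 + (k : ℝ) ^ 2)⁻¹ ≤ 2 * (((k : ℝ) + 1) ^ 2)⁻¹ := by
    rw [← div_eq_mul_inv, inv_eq_one_div, div_le_div_iff₀ (by positivity) (by positivity)]
    nlinarith [sq_nonneg ((k : ℝ) - 1)]
  refine (mul_le_mul h1 h2 (by positivity) (by positivity)).trans_eq ?_
  have e1 : (2 : ℝ) ^ d = 2 ^ (d - 1) * 2 := by
    rw [← pow_succ]; congr 1; omega
  have e2 : ((k : ℝ) + 1) ^ ((d : ℤ) - 3) = ((k : ℝ) + 1) ^ (d - 1) * (((k : ℝ) + 1) ^ 2)⁻¹ := by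
    rw [← zpow_natCast, ← zpow_natCast, ← zpow_neg, ← zpow_add₀ hk.ne']
    congr 1
    push_cast [Nat.cast_sub hd]
    ring
  rw [e1, e2]
  ring

theorem sum_range_zpow_le (hd : 1 ≤ d) (h2 : d = 2 → 2 ≤ n) :
    ∑ k ∈ Finset.range n, ((k : ℝ) + 1) ^ ((d : ℤ) - 3)
      ≤ 3 * ((n : ℝ) ^ ((d : ℤ) - 2) * greenOrder d n) := by
  have hn : (1 : ℝ) ≤ n := by exact_mod_cast NeZero.one_le (n := n)
  rcases (by omega : d = 1 ∨ d = 2 ∨ 3 ≤ d) with rfl | rfl | hd3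
  -- The correction `-1 / N` lets the induction telescope, since `1/(N + 1)² ≤ 1/N - 1/(N + 1)`.
  · have key : ∀ N : ℕ, 1 ≤ N →
        ∑ k ∈ Finset.range N, ((k : ℝ) + 1) ^ (((1 : ℕ) : ℤ) - 3) ≤ 2 - 1 / N := by
      intro N hN
      induction N, hN using Nat.le_induction with
      | base => norm_num
      | succ N hN ih =>
        rw [Finset.sum_range_succ]
        have hN' : (1 : ℝ) ≤ N := by exact_mod_cast hN
        have : ((N : ℝ) + 1) ^ (((1 : ℕ) : ℤ) - 3) ≤ 1 / N - 1 / ((N + 1 : ℕ) : ℝ) := by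
          have e : (((1 : ℕ) : ℤ) - 3) = -((2 : ℕ) : ℤ) := by norm_num
          rw [e, zpow_neg, zpow_natCast, div_sub_div _ _ (by positivity) (by positivity),
            inv_eq_one_div]
          push_cast
          rw [div_le_div_iff₀ (by positivity) (by positivity)]
          nlinarith
        linarith
    have e : (n : ℝ) ^ (((1 : ℕ) : ℤ) - 2) * greenOrder 1 n = 1 := by
      have : (((1 : ℕ) : ℤ) - 2) = -1 := by norm_num
      rw [this, zpow_neg_one]
      simp only [greenOrder, if_true]
      exact inv_mul_cancel₀ (by positivity)
    rw [e]
    have : 0 ≤ 1 / (n : ℝ) := by positivity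
    exact (key n NeZero.one_le).trans (by linarith)
  · have hn2 : (2 : ℝ) ≤ n := by exact_mod_cast h2 rfl
    have h := harmonic_le_one_add_log n
    have e : ∑ k ∈ Finset.range n, ((k : ℝ) + 1) ^ (((2 : ℕ) : ℤ) - 3) = harmonic n := by
      rw [harmonic]
      push_cast
      refine Finset.sum_congr rfl fun k _ => ?_
      norm_num
    rw [e]
    have e2 : (n : ℝ) ^ (((2 : ℕ) : ℤ) - 2) * greenOrder 2 n = Real.log n := by
      norm_num [greenOrder]
    rw [e2]
    -- Since `log 2 > 1/2`, the harmonic bound `1 + log n` is at most `3 log n`; this is where `n ≥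
    -- 2` is needed.
    have h3 : Real.log 2 ≤ Real.log n := Real.log_le_log two_pos hn2
    have := Real.log_two_gt_d9
    linarith
  · have e : greenOrder d n = 1 := by
      rw [greenOrder, if_neg (by omega), if_neg (by omega)]
    rw [e, mul_one]
    have h : ∀ k ∈ Finset.range n, ((k : ℝ) + 1) ^ ((d : ℤ) - 3) ≤ (n : ℝ) ^ ((d : ℤ) - 3) := by
      intro k hk
      have : ((k : ℝ) + 1) ≤ n := by exact_mod_cast Finset.mem_range.1 hk
      exact zpow_le_zpow_left₀ (by omega) (by positivity) this
    have h' := Finset.sum_le_sum h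
    rw [Finset.sum_const, Finset.card_range, nsmul_eq_mul] at h'
    have e2 : (n : ℝ) * (n : ℝ) ^ ((d : ℤ) - 3) = (n : ℝ) ^ ((d : ℤ) - 2) := by
      rw [← zpow_one_add₀ (by positivity)]
      congr 1; ring
    rw [e2] at h'
    have : 0 ≤ (n : ℝ) ^ ((d : ℤ) - 2) := by positivity
    linarith

theorem greenTrace_le (hd : 1 ≤ d) (h2 : d = 2 → 2 ≤ n) :
    greenTrace d n ≤ 6 * d * 2 ^ d * ((n : ℝ) ^ ((d : ℤ) - 2) * greenOrder d n) := by
  refine (greenTrace_le_sum hd).trans ?_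
  have h : ∑ k ∈ Finset.range n, 2 * ((2 * (k : ℝ) + 1) ^ (d - 1) * (1 + (k : ℝ) ^ 2)⁻¹)
      ≤ 2 * 2 ^ d * ∑ k ∈ Finset.range n, ((k : ℝ) + 1) ^ ((d : ℤ) - 3) := by
    rw [Finset.mul_sum]
    exact Finset.sum_le_sum fun k _ => by linarith [shell_term_le d k hd]
  have h' := mul_le_mul_of_nonneg_left (sum_range_zpow_le hd h2)
    (by positivity : (0 : ℝ) ≤ 2 * 2 ^ d)
  have := mul_le_mul_of_nonneg_left (h.trans h') (Nat.cast_nonneg (α := ℝ) d)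
  linarith

end Trace

/-! ### The particle system as a finite chain. -/

section Dynamics

variable {d n : ℕ} [NeZero n]

theorem bernoulliProd_eq (ρ : ℝ) (η : Config d n) : bernoulliProd d n ρ η = prodWt ρ η := by
  unfold bernoulliProd prodWt
  refine Finset.prod_congr rfl fun x _ => ?_
  cases h : η x <;> simp [occ, bernWt, h]

omit [NeZero n] in
theorem flipAt_eq (η : Config d n) (x : Torus d n) : flipAt η x = flipSite x η := by
  funext z
  simp only [flipAt, flipSite, Function.update_apply]

omit [NeZero n] in
theorem swapAt_eq (η : Config d n) (x y : Torus d n) : swapAt η x y = η ∘ Equiv.swap x y := by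
  funext z
  simp only [swapAt, Function.comp_apply, Equiv.swap_apply_def]
  split_ifs <;> rfl

omit [NeZero n] in
theorem swapAt_comm (η : Config d n) (x y : Torus d n) : swapAt η x y = swapAt η y x := by
  rw [swapAt_eq, swapAt_eq, Equiv.swap_comm]

omit [NeZero n] in
theorem swapAt_involutive (x y : Torus d n) :
    Function.Involutive fun η : Config d n => swapAt η x y := by
  intro η
  funext z
  simp [swapAt_eq]

theorem prodWt_swapAt (ρ : ℝ) (η : Config d n) (x y : Torus d n) :
    prodWt ρ (swapAt η x y) = prodWt ρ η := by
  rw [swapAt_eq]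
  exact Equiv.prod_comp (Equiv.swap x y) fun z => bernWt ρ (η z)

omit [NeZero n] in
theorem occ_nonneg (η : Config d n) (x : Torus d n) : 0 ≤ occ η x := by
  unfold occ; split_ifs <;> norm_num

omit [NeZero n] in
theorem occ_le_one (η : Config d n) (x : Torus d n) : occ η x ≤ 1 := by
  unfold occ; split_ifs <;> norm_num

/-- The neighbour of `x` in direction `p.1`, forwards or backwards. -/
def stepTo (x : Torus d n) (p : Fin d × Bool) : Torus d n :=
  if p.2 then x + unitVec p.1 else x - unitVec p.1

theorem nbrs_subset (x : Torus d n) : nbrs x ⊆ Finset.univ.image (stepTo x) := by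
  intro y hy
  simp only [nbrs, Finset.mem_filter, Finset.mem_univ, true_and] at hy
  obtain ⟨_, j, h | h⟩ := hy
  · exact Finset.mem_image.2 ⟨(j, true), Finset.mem_univ _, by simp [stepTo, unitVec, h]⟩
  · exact Finset.mem_image.2 ⟨(j, false), Finset.mem_univ _, by simp [stepTo, unitVec, h]⟩

theorem card_nbrs_le (x : Torus d n) : (nbrs x).card ≤ 2 * d := by
  refine (Finset.card_le_card (nbrs_subset x)).trans (Finset.card_image_le.trans ?_)
  simp [mul_comm]

theorem sum_occ_le (η : Config d n) (x : Torus d n) : ∑ y ∈ nbrs x, occ η y ≤ 2 * d := by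
  refine (Finset.sum_le_card_nsmul _ _ 1 fun y _ => occ_le_one η y).trans ?_
  rw [nsmul_eq_mul, mul_one]
  exact_mod_cast card_nbrs_le x

/-- At an empty site the interaction changes the birth rate by at most `|l| ≤ a / 2`, as there are
at most `2d` neighbours; at an occupied site the rate is `b`. -/
theorem le_rate {a b l : ℝ} (ha : 0 < a) (hd : 1 ≤ d) (hl : |l| ≤ a / 2) (x : Torus d n)
    (η : Config d n) : min (a / 2) b ≤ rate a b l x η := by
  have hd' : (0 : ℝ) < 2 * d := by positivity
  have h1 : -(a / 2) ≤ l / (2 * d) * ∑ y ∈ nbrs x, occ η y := by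
    have hs : 0 ≤ ∑ y ∈ nbrs x, occ η y := Finset.sum_nonneg fun y _ => occ_nonneg η y
    have : |l / (2 * d) * ∑ y ∈ nbrs x, occ η y| ≤ a / 2 := by
      rw [abs_mul, abs_div, abs_of_pos hd', abs_of_nonneg hs, div_mul_eq_mul_div,
        div_le_iff₀ hd']
      exact mul_le_mul hl (sum_occ_le η x) hs (by positivity)
    exact (abs_le.1 this).1
  unfold rate
  cases hx : η x
  · have ho : occ η x = 0 := by simp [occ, hx]
    rw [ho]
    linarith [min_le_left (a / 2) b]
  · have ho : occ η x = 1 := by simp [occ, hx]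
    rw [ho]
    linarith [min_le_right (a / 2) b]

open scoped Classical in
/-- The jump rates of the chain. -/
noncomputable def jumpRate (a b l : ℝ) (η η' : Config d n) : ℝ :=
  (n : ℝ) ^ 2 * ((1 / 2) * ∑ x : Torus d n, ∑ y ∈ nbrs x, if swapAt η x y = η' then 1 else 0)
    + ∑ x : Torus d n, rate a b l x η * if flipAt η x = η' then 1 else 0

theorem generator_eq (a b l : ℝ) (f : Config d n → ℝ) (η : Config d n) :
    generator d n a b l f η = ∑ η', jumpRate a b l η η' * (f η' - f η) := by
  classical
  have h : ∀ ξ : Config d n, f ξ - f η = ∑ η', (if ξ = η' then 1 else 0) * (f η' - f η) := by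
    intro ξ; simp
  have hL : generator d n a b l f η
      = (n : ℝ) ^ 2 * ((1 / 2) * ∑ x : Torus d n, ∑ y ∈ nbrs x, (f (swapAt η x y) - f η))
      + ∑ x : Torus d n, rate a b l x η * (f (flipAt η x) - f η) := rfl
  rw [hL]
  simp only [h (swapAt η _ _), h (flipAt η _), jumpRate, add_mul, Finset.sum_add_distrib,
    Finset.mul_sum, Finset.sum_mul]
  congr 1
  · conv_rhs => rw [Finset.sum_comm]
    refine Finset.sum_congr rfl fun x _ => ?_
    conv_rhs => rw [Finset.sum_comm]
    exact Finset.sum_congr rfl fun y _ => Finset.sum_congr rfl fun ξ _ => by ring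
  · rw [Finset.sum_comm]
    exact Finset.sum_congr rfl fun y _ => Finset.sum_congr rfl fun ξ _ => by ring

theorem jumpRate_nonneg {a b l : ℝ} (hr : ∀ x (η : Config d n), 0 < rate a b l x η)
    (η η' : Config d n) : 0 ≤ jumpRate a b l η η' := by
  unfold jumpRate
  exact add_nonneg (mul_nonneg (sq_nonneg _) (mul_nonneg (by norm_num)
    (Finset.sum_nonneg fun x _ => Finset.sum_nonneg fun y _ => by positivity)))
    (Finset.sum_nonneg fun x _ => mul_nonneg (hr x η).le (by positivity))

theorem jumpRate_flipAt_pos {a b l : ℝ} (hr : ∀ x (η : Config d n), 0 < rate a b l x η)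
    (η : Config d n) (x : Torus d n) : 0 < jumpRate a b l η (flipAt η x) := by
  classical
  unfold jumpRate
  refine add_pos_of_nonneg_of_pos (mul_nonneg (sq_nonneg _) (mul_nonneg (by norm_num)
    (Finset.sum_nonneg fun x _ => Finset.sum_nonneg fun y _ => by positivity))) ?_
  refine Finset.sum_pos' (fun y _ => mul_nonneg (hr y η).le (by positivity))
    ⟨x, Finset.mem_univ x, ?_⟩
  simpa using hr x η

/-- Flips alone connect all configurations: the sites of disagreement are corrected one at a time.
-/
theorem jumpRate_irreducible {a b l : ℝ} (hr : ∀ x (η : Config d n), 0 < rate a b l x η)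
    (η η' : Config d n) :
    Relation.ReflTransGen (fun u v => 0 < jumpRate a b l u v) η η' := by
  have key : ∀ B : Finset (Torus d n), Relation.ReflTransGen
      (fun u v => 0 < jumpRate a b l u v) η fun x => if x ∈ B then η' x else η x := by
    intro B
    induction B using Finset.induction_on with
    | empty => simpa using Relation.ReflTransGen.refl
    | insert z B hz ih =>
      by_cases h : η z = η' z
      · convert ih using 1
        funext x
        by_cases hx : x = z
        · subst hx; simp [hz, h]
        · simp [hx]
      · refine ih.tail ?_
        convert jumpRate_flipAt_pos hr (fun x => if x ∈ B then η' x else η x) z using 1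
        congr 1
        funext x
        by_cases hx : x = z
        · subst hx
          cases h1 : η x <;> cases h2 : η' x <;> simp_all [flipAt]
        · simp [flipAt, hx]
  simpa using key Finset.univ

theorem isInvariantProb_iff (a b l : ℝ) (μ : Config d n → ℝ) :
    IsInvariantProb d n a b l μ
      ↔ μ ∈ stdSimplex ℝ (Config d n) ∧ ∀ f, ∑ η, μ η * generator d n a b l f η = 0 := by
  let φ : (Config d n → ℝ) →L[ℝ] ℝ := ∑ η, μ η • ContinuousLinearMap.proj (R := ℝ) η
  have hφ : ∀ f, φ f = ∑ η, μ η * f η := fun f => by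
    simp [φ]
  have := forall_exp_apply_eq_iff (LinearMap.toContinuousLinearMap (generator d n a b l)) φ
  simp only [hφ] at this
  exact and_congr_right fun _ => this

theorem isInvariantProb_iff_balanced (a b l : ℝ) (μ : Config d n → ℝ) :
    IsInvariantProb d n a b l μ
      ↔ μ ∈ stdSimplex ℝ (Config d n) ∧ Balanced (jumpRate a b l) μ := by
  rw [isInvariantProb_iff, balanced_iff]
  simp only [generator_eq]

theorem existsUnique_isInvariantProb {a b l : ℝ} (hr : ∀ x (η : Config d n), 0 < rate a b l x η) :
    ∃! μ : Config d n → ℝ, IsInvariantProb d n a b l μ := by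
  simp only [isInvariantProb_iff_balanced]
  obtain ⟨m, hm, hb⟩ := exists_balanced (jumpRate_nonneg hr)
  exact ⟨m, ⟨hm, hb⟩, fun m' h' =>
    Balanced.unique (jumpRate_nonneg hr) (jumpRate_irreducible hr) h'.2 h'.1 hb hm⟩

theorem IsInvariantProb.pos {a b l : ℝ} (hr : ∀ x (η : Config d n), 0 < rate a b l x η)
    {μ : Config d n → ℝ} (h : IsInvariantProb d n a b l μ) (η : Config d n) : 0 < μ η := by
  rw [isInvariantProb_iff_balanced] at h
  exact h.2.pos (jumpRate_nonneg hr) (jumpRate_irreducible hr) h.1 η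

theorem prodWt_pos {S : Type*} [Fintype S] {ρ : ℝ} (h0 : 0 < ρ) (h1 : ρ < 1) (η : S → Bool) :
    0 < prodWt ρ η :=
  Finset.prod_pos fun x _ => by unfold bernWt; split_ifs <;> linarith

/-- A crude entropy bound: the reference measure charges each configuration by at least
`δ ^ (n ^ d)`. -/
theorem relEntropy_le_of_le {ρ δ : ℝ} (hδ : 0 < δ) (h0 : δ ≤ ρ) (h1 : δ ≤ 1 - ρ)
    {μ : Config d n → ℝ} (hμ : μ ∈ stdSimplex ℝ (Config d n)) :
    relEntropy (density μ (bernoulliProd d n ρ)) (bernoulliProd d n ρ)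
      ≤ (n : ℝ) ^ d * (-Real.log δ) := by
  have hν : ∀ η : Config d n, 0 < bernoulliProd d n ρ η := fun η => by
    rw [bernoulliProd_eq]; exact prodWt_pos (by linarith) (by linarith) η
  have hle : ∀ η : Config d n, δ ^ (n ^ d) ≤ bernoulliProd d n ρ η := by
    intro η
    rw [bernoulliProd_eq]
    have : δ ^ (n ^ d) = ∏ _x : Torus d n, δ := by simp
    rw [this]
    refine Finset.prod_le_prod (fun _ _ => hδ.le) fun x _ => ?_
    unfold bernWt
    split_ifs <;> linarith
  have hterm : ∀ η : Config d n, bernoulliProd d n ρ η * (density μ (bernoulliProd d n ρ) η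
      * Real.log (density μ (bernoulliProd d n ρ) η)) ≤ μ η * ((n : ℝ) ^ d * (-Real.log δ)) := by
    intro η
    have e : bernoulliProd d n ρ η * (density μ (bernoulliProd d n ρ) η
        * Real.log (density μ (bernoulliProd d n ρ) η))
        = μ η * Real.log (density μ (bernoulliProd d n ρ) η) := by
      rw [← mul_assoc]
      congr 1
      unfold density
      exact mul_div_cancel₀ _ (hν η).ne'
    rw [e]
    have hμη := hμ.1 η
    have hμ1 : μ η ≤ 1 := hμ.2 ▸ Finset.single_le_sum (fun η _ => hμ.1 η) (Finset.mem_univ η)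
    rcases hμη.eq_or_lt with h | h
    · rw [← h]; simp
    · refine mul_le_mul_of_nonneg_left ?_ hμη
      rw [density, Real.log_div h.ne' (hν η).ne']
      have l1 : Real.log (μ η) ≤ 0 := Real.log_nonpos hμη hμ1
      have l2 := Real.log_le_log (by positivity) (hle η)
      rw [Real.log_pow] at l2
      push_cast at l2
      linarith
  refine (Finset.sum_le_sum fun η _ => hterm η).trans_eq ?_
  rw [← Finset.sum_mul, hμ.2, one_mul]

end Dynamics

/-! ### Entropy production and correlation estimates. -/

section Production

variable {d n : ℕ} [NeZero n]

omit [NeZero n] in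
theorem unitVec_apply (i j : Fin d) : (unitVec i : Torus d n) j = if j = i then 1 else 0 := by
  simp [unitVec, Pi.single_apply]

theorem mem_nbrs {x y : Torus d n} : y ∈ nbrs x ↔ Nbr x y := by
  simp [nbrs]

-- The `2d` steps are distinct because `1 ≠ -1` modulo `n ≥ 3`. For `n = 2` opposite steps coincide,
-- so neighbour sums no longer agree with `adjOp`.
omit [NeZero n] in
theorem stepTo_injective (hn : 3 ≤ n) (x : Torus d n) : Function.Injective (stepTo x) := by
  have h1 : (1 : ZMod n) ≠ 0 := by
    have : Fact (1 < n) := ⟨by omega⟩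
    exact one_ne_zero
  have h2 : (1 : ZMod n) ≠ -1 := by
    intro h
    have h' : ((2 : ℕ) : ZMod n) = 0 := by
      push_cast
      linear_combination h
    rw [ZMod.natCast_eq_zero_iff] at h'
    exact absurd (Nat.le_of_dvd two_pos h') (by omega)
  rintro ⟨i, s⟩ ⟨j, t⟩ h
  have hi := congrFun h i
  cases s <;> cases t <;> by_cases hij : i = j <;>
    simp [stepTo, unitVec_apply, hij, h1, sub_eq_add_neg, h2, h2.symm] at hi ⊢

theorem nbrs_eq (hn : 3 ≤ n) (x : Torus d n) : nbrs x = Finset.univ.image (stepTo x) := by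
  refine (nbrs_subset x).antisymm fun y hy => ?_
  obtain ⟨⟨j, s⟩, _, rfl⟩ := Finset.mem_image.1 hy
  have := unitVec_ne_zero (n := n) (by omega) j
  rw [mem_nbrs]
  cases s
  · refine ⟨by simpa [stepTo, sub_eq_add_neg] using this, j, Or.inr ?_⟩
    simp [stepTo, unitVec]
  · refine ⟨by simpa [stepTo] using this, j, Or.inl ?_⟩
    simp [stepTo, unitVec]

theorem sum_nbrs (hn : 3 ≤ n) (x : Torus d n) (g : Torus d n → ℝ) :
    ∑ y ∈ nbrs x, g y = adjOp g x := by
  rw [nbrs_eq hn, Finset.sum_image fun p _ q _ h => stepTo_injective hn x h,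
    Fintype.sum_prod_type, adjOp]
  simp [stepTo]

theorem card_nbrs (hn : 3 ≤ n) (x : Torus d n) : ((nbrs x).card : ℝ) = 2 * d := by
  have := sum_nbrs hn x (fun _ => 1)
  simp [adjOp] at this
  rw [this]; ring

theorem sum_pairs_eq (hn : 3 ≤ n) (g : Torus d n → Torus d n → ℝ) (hg : ∀ x y, g x y = g y x) :
    (1 / 2) * ∑ x, ∑ y ∈ nbrs x, g x y = ∑ j : Fin d, ∑ x, g x (x + unitVec j) := by
  simp only [sum_nbrs hn, adjOp]
  rw [Finset.sum_comm, Finset.mul_sum]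
  refine Finset.sum_congr rfl fun j _ => ?_
  have h := sum_sub_right_eq (fun x => g x (x + unitVec j)) (unitVec j)
  simp only [sub_add_cancel] at h
  rw [Finset.sum_add_distrib]
  simp only [fun x => hg x (x - unitVec j), h]
  ring

theorem generator_eq_bonds (hn : 3 ≤ n) (a b l : ℝ) (f : Config d n → ℝ) (η : Config d n) :
    generator d n a b l f η
      = (n : ℝ) ^ 2 * ∑ j : Fin d, ∑ x, (f (swapAt η x (x + unitVec j)) - f η)
        + ∑ x, rate a b l x η * (f (flipSite x η) - f η) := by
  rw [← sum_pairs_eq hn (fun x y => f (swapAt η x y) - f η) fun x y => by rw [swapAt_comm]]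
  simp only [← flipAt_eq]
  rfl

/-- This is `log y ≤ y - 1` at `y = √(v / u)`. Going through the square root produces the Dirichlet
form of `√f` in the entropy production. -/
theorem mul_log_sub_log_le {u v : ℝ} (hu : 0 < u) (hv : 0 < v) :
    u * (Real.log v - Real.log u) ≤ -(√v - √u) ^ 2 + (v - u) := by
  have hs := Real.sqrt_pos.2 hu
  have ht := Real.sqrt_pos.2 hv
  have h := Real.log_le_sub_one_of_pos (div_pos ht hs)
  rw [Real.log_div ht.ne' hs.ne', Real.log_sqrt hv.le, Real.log_sqrt hu.le] at h
  have e1 := Real.sq_sqrt hu.le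
  have e2 := Real.sq_sqrt hv.le
  have h3 : u * (√v / √u - 1) = √u * √v - u := by
    have : u * (√v / √u) = √u * √v := by
      field_simp
      rw [e1]
    rw [mul_sub, this, mul_one]
  have := mul_le_mul_of_nonneg_left h hu.le
  nlinarith

omit [NeZero n] in
theorem occ_eq (ρ : ℝ) (η : Config d n) (x : Torus d n) : occ η x = centred ρ η x + ρ := by
  simp [occ, centred]

theorem not_mem_nbrs_self (x : Torus d n) : x ∉ nbrs x := by
  simp [mem_nbrs, Nbr]

theorem sum_nbrs_occ_flipSite (x : Torus d n) (η : Config d n) :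
    ∑ y ∈ nbrs x, occ (flipSite x η) y = ∑ y ∈ nbrs x, occ η y := by
  refine Finset.sum_congr rfl fun y hy => ?_
  have : y ≠ x := fun h => not_mem_nbrs_self x (h ▸ hy)
  simp [occ, flipSite, this]

/-- The adjoint of the flip dynamics at `x`, applied to the constant function one. -/
theorem adjoint_flip_one (hn : 3 ≤ n) (hd : 1 ≤ d) {a b l ρ : ℝ} (h0 : 0 < ρ) (h1 : ρ < 1)
    (hF : reactionF a b l ρ = 0) (x : Torus d n) (η : Config d n) :
    prodWt ρ (flipSite x η) * rate a b l x (flipSite x η) - prodWt ρ η * rate a b l x η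
      = prodWt ρ η * (l / (2 * d * ρ) * (centred ρ η x * adjOp (centred ρ η) x)) := by
  have hd' : (d : ℝ) ≠ 0 := by positivity
  have h1' : 1 - ρ ≠ 0 := by linarith
  have hs : ∑ y ∈ nbrs x, occ η y = adjOp (centred ρ η) x + 2 * d * ρ := by
    simp only [occ_eq ρ]
    rw [Finset.sum_add_distrib, Finset.sum_const, nsmul_eq_mul, card_nbrs hn, sum_nbrs hn]
  have hw := prodWt_flipSite ρ x η
  unfold rate
  rw [sum_nbrs_occ_flipSite, hs]
  unfold reactionF at hF
  generalize adjOp (centred ρ η) x = A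
  -- In both cases `F(ρ) = 0` cancels everything except the term linear in the neighbours'
  -- fluctuation `A`.
  cases hx : η x
  · have e1 : occ (flipSite x η) x = 1 := by simp [occ, flipSite, hx]
    have e2 : occ η x = 0 := by simp [occ, hx]
    have e3 : centred ρ η x = -ρ := by simp [centred, hx]
    rw [hx] at hw
    simp only [bernWt, Bool.false_eq_true, if_false, Bool.not_false, if_true] at hw
    have hw' : prodWt ρ (flipSite x η) = prodWt ρ η * ρ / (1 - ρ) := by
      rw [eq_div_iff h1', hw]
    rw [e1, e2, e3, hw']
    field_simp
    linear_combination (-(2 * d)) * prodWt ρ η * hF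
  · have e1 : occ (flipSite x η) x = 0 := by simp [occ, flipSite, hx]
    have e2 : occ η x = 1 := by simp [occ, hx]
    have e3 : centred ρ η x = 1 - ρ := by simp [centred, hx]
    rw [hx] at hw
    simp only [bernWt, Bool.false_eq_true, if_false, Bool.not_true, if_true] at hw
    have hw' : prodWt ρ (flipSite x η) = prodWt ρ η * (1 - ρ) / ρ := by
      rw [eq_div_iff h0.ne', hw]
    rw [e1, e2, e3, hw']
    field_simp
    linear_combination (2 * d) * prodWt ρ η * hF

/-- The Dirichlet form of the exclusion dynamics, for the square root of a density. -/
noncomputable def swapEnergy (ρ : ℝ) (f : Config d n → ℝ) : ℝ :=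
  ∑ j : Fin d, ∑ x, ∑ η, prodWt ρ η * (√(f (swapAt η x (x + unitVec j))) - √(f η)) ^ 2

theorem sum_prodWt_swapAt (ρ : ℝ) (x y : Torus d n) (g : Config d n → ℝ) :
    ∑ η, prodWt ρ η * g (swapAt η x y) = ∑ η, prodWt ρ η * g η := by
  rw [← (swapAt_involutive x y).bijective.sum_comp (fun η => prodWt ρ η * g η)]
  simp only [prodWt_swapAt]

/-- The exclusion part integrates to zero because exchanges preserve the product weight. Changing
variables in each flip moves the reaction part onto the constant function 1. -/
theorem sum_prodWt_generator (hn : 3 ≤ n) (hd : 1 ≤ d) {a b l ρ : ℝ} (h0 : 0 < ρ) (h1 : ρ < 1)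
    (hF : reactionF a b l ρ = 0) (f : Config d n → ℝ) :
    ∑ η, prodWt ρ η * generator d n a b l f η
      = l / (2 * d * ρ) * ∑ η, prodWt ρ η *
        ((∑ x, centred ρ η x * adjOp (centred ρ η) x) * f η) := by
  have hswap : ∑ η, prodWt ρ η * ((n : ℝ) ^ 2 *
      ∑ j : Fin d, ∑ x, (f (swapAt η x (x + unitVec j)) - f η)) = 0 := by
    simp only [mul_left_comm (prodWt ρ _), ← Finset.mul_sum]
    refine mul_eq_zero_of_right _ ?_
    simp only [Finset.mul_sum]
    rw [Finset.sum_comm]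
    refine Finset.sum_eq_zero fun j _ => ?_
    rw [Finset.sum_comm]
    refine Finset.sum_eq_zero fun x _ => ?_
    simp only [mul_sub, Finset.sum_sub_distrib]
    rw [sum_prodWt_swapAt ρ x (x + unitVec j) f, sub_self]
  have hflip : ∀ x : Torus d n, ∑ η, prodWt ρ η * (rate a b l x η * (f (flipSite x η) - f η))
      = ∑ η, l / (2 * d * ρ) * (prodWt ρ η *
        (centred ρ η x * adjOp (centred ρ η) x * f η)) := by
    intro x
    have e : ∑ η, prodWt ρ η * (rate a b l x η * f (flipSite x η))
        = ∑ η, prodWt ρ (flipSite x η) * (rate a b l x (flipSite x η) * f η) := by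
      rw [← (flipSite_involutive x).bijective.sum_comp
        (fun η => prodWt ρ (flipSite x η) * (rate a b l x (flipSite x η) * f η))]
      simp only [(flipSite_involutive x) _]
    simp only [mul_sub, Finset.sum_sub_distrib]
    rw [e, ← Finset.sum_sub_distrib]
    refine Finset.sum_congr rfl fun η _ => ?_
    linear_combination f η * adjoint_flip_one hn hd h0 h1 hF x η
  simp only [generator_eq_bonds hn, mul_add, Finset.sum_add_distrib]
  rw [hswap, zero_add]
  simp only [Finset.mul_sum]
  rw [Finset.sum_comm]
  simp only [hflip]
  rw [Finset.sum_comm]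
  refine Finset.sum_congr rfl fun η _ => ?_
  rw [Finset.sum_mul, Finset.mul_sum, Finset.mul_sum]

/-- Entropy production in the stationary state. -/
theorem energy_le_of_invariant (hn : 3 ≤ n) (hd : 1 ≤ d) {a b l ρ c : ℝ} (h0 : 0 < ρ) (h1 : ρ < 1)
    (hF : reactionF a b l ρ = 0) (hc : ∀ x (η : Config d n), c ≤ rate a b l x η)
    {f : Config d n → ℝ} (hf : ∀ η, 0 < f η) (hc0 : 0 ≤ c)
    (hinv : ∀ g : Config d n → ℝ, ∑ η, prodWt ρ η * f η * generator d n a b l g η = 0) :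
    (n : ℝ) ^ 2 * swapEnergy ρ f + c * ∑ x, flipEnergy ρ x f
      ≤ l / (2 * d * ρ) * ∑ η, prodWt ρ η *
        ((∑ x, centred ρ η x * adjOp (centred ρ η) x) * f η) := by
  rw [← sum_prodWt_generator hn hd h0 h1 hF]
  -- Stationarity is tested with `log f`: the left side sums to zero, while `mul_log_sub_log_le`
  -- extracts the two Dirichlet forms.
  have key : ∀ η, prodWt ρ η * f η * generator d n a b l (fun ξ => Real.log (f ξ)) η
      ≤ prodWt ρ η * generator d n a b l f η
        - ((n : ℝ) ^ 2 * ∑ j : Fin d, ∑ x, prodWt ρ η *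
            (√(f (swapAt η x (x + unitVec j))) - √(f η)) ^ 2
          + c * ∑ x, prodWt ρ η * (√(f (flipSite x η)) - √(f η)) ^ 2) := by
    intro η
    rw [generator_eq_bonds hn, generator_eq_bonds hn, ← Finset.mul_sum]
    simp only [← Finset.mul_sum]
    have hw := prodWt_nonneg h0.le h1.le η
    have hA : f η * ∑ j : Fin d, ∑ x,
        (Real.log (f (swapAt η x (x + unitVec j))) - Real.log (f η))
        ≤ ∑ j : Fin d, ∑ x, (f (swapAt η x (x + unitVec j)) - f η)
          - ∑ j : Fin d, ∑ x, (√(f (swapAt η x (x + unitVec j))) - √(f η)) ^ 2 := by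
      simp only [Finset.mul_sum, ← Finset.sum_sub_distrib]
      exact Finset.sum_le_sum fun j _ => Finset.sum_le_sum fun x _ => by
        linarith [mul_log_sub_log_le (hf η) (hf (swapAt η x (x + unitVec j)))]
    have hB : f η * ∑ x, rate a b l x η * (Real.log (f (flipSite x η)) - Real.log (f η))
        ≤ ∑ x, rate a b l x η * (f (flipSite x η) - f η)
          - c * ∑ x, (√(f (flipSite x η)) - √(f η)) ^ 2 := by
      simp only [Finset.mul_sum, ← Finset.sum_sub_distrib]
      refine Finset.sum_le_sum fun x _ => ?_
      have hr := hc x η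
      have h2 := mul_le_mul_of_nonneg_left (mul_log_sub_log_le (hf η) (hf (flipSite x η)))
        (hc0.trans hr)
      have h3 := mul_le_mul_of_nonneg_right hr (sq_nonneg (√(f (flipSite x η)) - √(f η)))
      linarith
    have hA' := mul_le_mul_of_nonneg_left hA (mul_nonneg hw (sq_nonneg (n : ℝ)))
    have hB' := mul_le_mul_of_nonneg_left hB hw
    linarith
  have hs := Finset.sum_le_sum fun η (_ : η ∈ Finset.univ) => key η
  rw [hinv, Finset.sum_sub_distrib, Finset.sum_add_distrib, ← Finset.mul_sum,
    ← Finset.mul_sum] at hs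
  have e1 : ∑ η, ∑ j : Fin d, ∑ x, prodWt ρ η *
      (√(f (swapAt η x (x + unitVec j))) - √(f η)) ^ 2 = swapEnergy ρ f := by
    rw [Finset.sum_comm, swapEnergy]
    exact Finset.sum_congr rfl fun j _ => Finset.sum_comm
  have e2 : ∑ η, ∑ x, prodWt ρ η * (√(f (flipSite x η)) - √(f η)) ^ 2
      = ∑ x, flipEnergy ρ x f := by
    rw [Finset.sum_comm]; rfl
  rw [e1, e2] at hs
  linarith

/-- Integration by parts along an involution that preserves the weight. -/
theorem abs_sum_antisymm_le {Ω : Type*} [Fintype Ω] {w A h f : Ω → ℝ} {τ : Ω → Ω}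
    (hτ : Function.Involutive τ) (hw0 : ∀ η, 0 ≤ w η) (hw : ∀ η, w (τ η) = w η)
    (hA : ∀ η, A (τ η) = -A η) (hA1 : ∀ η, |A η| ≤ 1) (hh : ∀ η, h (τ η) = h η)
    (hf : ∀ η, 0 ≤ f η) :
    |∑ η, w η * (A η * h η * f η)|
      ≤ (1 / 4) * ∑ η, w η * (√(f (τ η)) - √(f η)) ^ 2 + ∑ η, w η * (h η ^ 2 * f η) := by
  have e1 : ∑ η, w η * (A η * h η * f η) = -∑ η, w η * (A η * h η * f (τ η)) := by
    rw [← hτ.bijective.sum_comp, ← Finset.sum_neg_distrib]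
    exact Finset.sum_congr rfl fun η _ => by rw [hw, hA, hh]; ring
  have e2 : ∑ η, w η * (h η ^ 2 * f (τ η)) = ∑ η, w η * (h η ^ 2 * f η) := by
    rw [← hτ.bijective.sum_comp (fun η => w η * (h η ^ 2 * f η))]
    exact Finset.sum_congr rfl fun η _ => by rw [hw, hh]
  -- Antisymmetrizing yields the increment of `f`, which factors as a difference times a sum of
  -- square roots; Young's inequality then separates them.
  have e3 : ∑ η, w η * (A η * h η * f η)
      = (1 / 2) * ∑ η, w η * (A η * h η * (f η - f (τ η))) := by
    simp only [mul_sub, Finset.sum_sub_distrib]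
    linarith
  have hpt : ∀ η, |w η * (A η * h η * (f η - f (τ η)))|
      ≤ w η * ((√(f (τ η)) - √(f η)) ^ 2 / 2) + w η * (h η ^ 2 * f η)
        + w η * (h η ^ 2 * f (τ η)) := by
    intro η
    rw [abs_mul, abs_of_nonneg (hw0 η), ← mul_add, ← mul_add]
    refine mul_le_mul_of_nonneg_left ?_ (hw0 η)
    have hs := Real.sq_sqrt (hf η)
    have ht := Real.sq_sqrt (hf (τ η))
    have hs0 := Real.sqrt_nonneg (f η)
    have ht0 := Real.sqrt_nonneg (f (τ η))
    set s := √(f η)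
    set t := √(f (τ η))
    rw [← hs, ← ht, mul_assoc, abs_mul]
    refine (mul_le_of_le_one_left (abs_nonneg _) (hA1 η)).trans ?_
    rw [abs_le]
    have hq : (h η * (s + t)) ^ 2 ≤ 2 * (h η ^ 2 * (s ^ 2 + t ^ 2)) := by
      nlinarith [mul_nonneg (sq_nonneg (h η)) (sq_nonneg (s - t))]
    constructor
    · nlinarith [sq_nonneg (h η * (s + t) + (s - t))]
    · nlinarith [sq_nonneg (h η * (s + t) - (s - t))]
  have hsum := (Finset.abs_sum_le_sum_abs (fun η => w η * (A η * h η * (f η - f (τ η))))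
    Finset.univ).trans (Finset.sum_le_sum fun η _ => hpt η)
  simp only [Finset.sum_add_distrib] at hsum
  rw [e2] at hsum
  have e4 : ∑ η, w η * ((√(f (τ η)) - √(f η)) ^ 2 / 2)
      = (∑ η, w η * (√(f (τ η)) - √(f η)) ^ 2) / 2 := by
    rw [Finset.sum_div]
    exact Finset.sum_congr rfl fun η _ => by ring
  rw [e4] at hsum
  rw [e3, abs_mul, abs_of_pos (by norm_num : (0:ℝ) < 1 / 2)]
  linarith

omit [NeZero n] in
theorem abs_grad_centred_le (ρ : ℝ) (η : Config d n) (j : Fin d) (x : Torus d n) :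
    |grad j (centred ρ η) x| ≤ 1 := by
  unfold grad centred
  rw [abs_le]
  constructor <;> split_ifs <;> linarith

/-- Under exchange of the endpoints the gradient is odd and the flux even, so integration by parts
applies. -/
theorem sum_gradient_flux_le (hn : 3 ≤ n) {ρ : ℝ} (h0 : 0 ≤ ρ) (h1 : ρ ≤ 1)
    {f : Config d n → ℝ} (hf : ∀ η, 0 ≤ f η) (j : Fin d) (x : Torus d n) :
    |∑ η, prodWt ρ η * (grad j (centred ρ η) x * flux j (centred ρ η) x * f η)|
      ≤ (1 / 4) * ∑ η, prodWt ρ η * (√(f (swapAt η x (x + unitVec j))) - √(f η)) ^ 2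
        + ∑ η, prodWt ρ η * (flux j (centred ρ η) x ^ 2 * f η) := by
  refine abs_sum_antisymm_le (swapAt_involutive x (x + unitVec j)) (prodWt_nonneg h0 h1)
    (fun η => prodWt_swapAt ρ η _ _) (fun η => ?_) (fun η => abs_grad_centred_le ρ η j x)
    (fun η => ?_) hf
  · simp [grad, centred, swapAt_eq]
  · refine flux_congr (by omega) j x fun z hz1 hz2 => ?_
    simp [centred, swapAt, hz1, hz2]

/-- The nearest-neighbour correlations are controlled by the exclusion energy and by the
expectation of `greenForm`. -/
theorem abs_sum_correlation_le (hn : 3 ≤ n) {ρ : ℝ} (h0 : 0 ≤ ρ) (h1 : ρ ≤ 1)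
    {f : Config d n → ℝ} (hf : ∀ η, 0 ≤ f η) (hf1 : ∑ η, prodWt ρ η * f η = 1) :
    |∑ η, prodWt ρ η * ((∑ x, centred ρ η x * adjOp (centred ρ η) x) * f η)|
      ≤ (n : ℝ) ^ 2 * swapEnergy ρ f / 4
        + (2 * d + 8 * (d : ℝ) ^ 2) * ∑ η, prodWt ρ η * (greenForm (centred ρ η) * f η)
        + 3 * d * greenTrace d n := by
  set Φ := ∑ η, prodWt ρ η * (greenForm (centred ρ η) * f η) with hΦ
  have hwf : ∀ η, 0 ≤ prodWt ρ η * f η := fun η => mul_nonneg (prodWt_nonneg h0 h1 η) (hf η)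
  have hg : ∀ (η : Config d n) j x, grad j (centred ρ η) x ^ 2 ≤ 1 := fun η j x => by
    rw [← sq_abs]
    exact pow_le_one₀ (abs_nonneg _) (abs_grad_centred_le ρ η j x)
  have hdom : ∀ (g G : Config d n → ℝ), (∀ η, |g η| ≤ G η) →
      |∑ η, prodWt ρ η * (g η * f η)| ≤ ∑ η, prodWt ρ η * (G η * f η) := by
    intro g G h
    refine (Finset.abs_sum_le_sum_abs _ _).trans (Finset.sum_le_sum fun η _ => ?_)
    rw [mul_left_comm, abs_mul, abs_of_nonneg (hwf η), mul_left_comm (prodWt ρ η)]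
    exact mul_le_mul_of_nonneg_right (h η) (hwf η)
  have hlin : ∀ (α β : ℝ), ∑ η, prodWt ρ η * ((α * greenForm (centred ρ η) + β) * f η)
      = α * Φ + β := by
    intro α β
    calc _ = ∑ η, (α * (prodWt ρ η * (greenForm (centred ρ η) * f η))
          + β * (prodWt ρ η * f η)) := Finset.sum_congr rfl fun η _ => by ring
      _ = _ := by
        rw [Finset.sum_add_distrib, ← Finset.mul_sum, ← Finset.mul_sum, hf1, mul_one]
  have hT1 := hdom (fun η => ∑ x, centred ρ η x * adjOp (conv green (centred ρ η)) x)
    (fun η => 2 * d * greenForm (centred ρ η) + 0)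
    fun η => by simpa using abs_sum_mul_adjOp_conv_green_le (centred ρ η)
  rw [hlin] at hT1
  have hT3 := hdom (fun η => (n : ℝ) ^ 2 * ∑ j : Fin d, ∑ x,
      bondCoeff n j * grad j (centred ρ η) x ^ 2)
    (fun η => 0 * greenForm (centred ρ η) + d * greenTrace d n)
    fun η => by simpa using abs_bondCoeff_term_le (by omega) (centred ρ η) (hg η)
  rw [hlin] at hT3
  have hflux : (n : ℝ) ^ 2 * ∑ j : Fin d, ∑ x, ∑ η,
      prodWt ρ η * (flux j (centred ρ η) x ^ 2 * f η)
      ≤ 8 * (d : ℝ) ^ 2 * Φ + 2 * d * greenTrace d n := by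
    rw [← hlin]
    have e : (n : ℝ) ^ 2 * ∑ j : Fin d, ∑ x, ∑ η,
        prodWt ρ η * (flux j (centred ρ η) x ^ 2 * f η)
        = ∑ η, prodWt ρ η * f η * ((n : ℝ) ^ 2 * ∑ j : Fin d, ∑ x,
          flux j (centred ρ η) x ^ 2) := by
      have : ∀ j : Fin d, ∑ x, ∑ η, prodWt ρ η * (flux j (centred ρ η) x ^ 2 * f η)
          = ∑ η, ∑ x, prodWt ρ η * (flux j (centred ρ η) x ^ 2 * f η) :=
        fun j => Finset.sum_comm
      simp only [this]
      rw [Finset.sum_comm]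
      simp only [Finset.mul_sum]
      exact Finset.sum_congr rfl fun η _ => Finset.sum_congr rfl fun j _ =>
        Finset.sum_congr rfl fun x _ => by ring
    rw [e]
    refine Finset.sum_le_sum fun η _ => ?_
    rw [mul_left_comm (prodWt ρ η), mul_comm (prodWt ρ η * f η)]
    exact mul_le_mul_of_nonneg_right (sum_flux_sq_le (by omega) _ (hg η)) (hwf η)
  have hT2 : |∑ η, prodWt ρ η * (((n : ℝ) ^ 2 * ∑ j : Fin d, ∑ x,
      grad j (centred ρ η) x * flux j (centred ρ η) x) * f η)|
      ≤ (n : ℝ) ^ 2 * swapEnergy ρ f / 4 + (8 * (d : ℝ) ^ 2 * Φ + 2 * d * greenTrace d n) := by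
    have e : ∑ η, prodWt ρ η * (((n : ℝ) ^ 2 * ∑ j : Fin d, ∑ x,
        grad j (centred ρ η) x * flux j (centred ρ η) x) * f η)
        = (n : ℝ) ^ 2 * ∑ j : Fin d, ∑ x, ∑ η, prodWt ρ η *
          (grad j (centred ρ η) x * flux j (centred ρ η) x * f η) := by
      have : ∀ j : Fin d, ∑ x, ∑ η, prodWt ρ η *
          (grad j (centred ρ η) x * flux j (centred ρ η) x * f η)
          = ∑ η, ∑ x, prodWt ρ η *
          (grad j (centred ρ η) x * flux j (centred ρ η) x * f η) :=
        fun j => Finset.sum_comm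
      simp only [this]
      rw [Finset.sum_comm]
      simp only [Finset.mul_sum, Finset.sum_mul]
      exact Finset.sum_congr rfl fun η _ => Finset.sum_congr rfl fun j _ =>
        Finset.sum_congr rfl fun x _ => by ring
    have hb : |∑ j : Fin d, ∑ x, ∑ η, prodWt ρ η *
        (grad j (centred ρ η) x * flux j (centred ρ η) x * f η)|
        ≤ (1 / 4) * swapEnergy ρ f + ∑ j : Fin d, ∑ x, ∑ η,
          prodWt ρ η * (flux j (centred ρ η) x ^ 2 * f η) := by
      rw [swapEnergy]
      simp only [Finset.mul_sum (a := (1 / 4 : ℝ)) (s := (Finset.univ : Finset (Fin d))),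
        Finset.mul_sum (a := (1 / 4 : ℝ)) (s := (Finset.univ : Finset (Torus d n))),
        ← Finset.sum_add_distrib]
      refine (Finset.abs_sum_le_sum_abs _ _).trans (Finset.sum_le_sum fun j _ => ?_)
      refine (Finset.abs_sum_le_sum_abs _ _).trans (Finset.sum_le_sum fun x _ => ?_)
      refine (sum_gradient_flux_le hn h0 h1 hf j x).trans_eq ?_
      rw [Finset.mul_sum, ← Finset.sum_add_distrib]
    rw [e, abs_mul, abs_of_nonneg (by positivity : (0:ℝ) ≤ (n:ℝ) ^ 2)]
    have := mul_le_mul_of_nonneg_left hb (by positivity : (0:ℝ) ≤ (n:ℝ) ^ 2)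
    linarith
  have hdec : ∑ η, prodWt ρ η * ((∑ x, centred ρ η x * adjOp (centred ρ η) x) * f η)
      = ∑ η, prodWt ρ η * ((∑ x, centred ρ η x * adjOp (conv green (centred ρ η)) x) * f η)
      + ∑ η, prodWt ρ η * (((n : ℝ) ^ 2 * ∑ j : Fin d, ∑ x,
        grad j (centred ρ η) x * flux j (centred ρ η) x) * f η)
      + ∑ η, prodWt ρ η * (((n : ℝ) ^ 2 * ∑ j : Fin d, ∑ x,
        bondCoeff n j * grad j (centred ρ η) x ^ 2) * f η) := by
    rw [← Finset.sum_add_distrib, ← Finset.sum_add_distrib]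
    exact Finset.sum_congr rfl fun η _ => by rw [sum_mul_adjOp_eq (centred ρ η)]; ring
  rw [hdec]
  refine (abs_add_three _ _ _).trans ?_
  linarith

end Production

/-! ### Closing the estimate and choosing the constants. -/

section Main

variable {d n : ℕ} [NeZero n]

/-- The exclusion energy from the correlation bound is absorbed on the left. The logarithmic Sobolev
inequality leaves `c H / 2` against at most `c H / 4` plus a multiple of the trace. -/
theorem relEntropy_le_greenTrace (hn : 3 ≤ n) (hd : 1 ≤ d) {a b l ρ c : ℝ} (h0 : 0 < ρ)
    (h1 : ρ < 1) (hF : reactionF a b l ρ = 0) (hc0 : 0 < c)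
    (hc : ∀ x (η : Config d n), c ≤ rate a b l x η)
    (hl1 : |l / (2 * d * ρ)| ≤ 1)
    (hl2 : |l / (2 * d * ρ)| * (2 * d + 8 * (d : ℝ) ^ 2) ≤ c / 4)
    {μ : Config d n → ℝ} (hμ : IsInvariantProb d n a b l μ) :
    relEntropy (density μ (bernoulliProd d n ρ)) (bernoulliProd d n ρ)
      ≤ 4 / c * (5 * d + 8 * (d : ℝ) ^ 2) * greenTrace d n := by
  have hr : ∀ x (η : Config d n), 0 < rate a b l x η := fun x η => hc0.trans_le (hc x η)
  have hν : bernoulliProd d n ρ = prodWt ρ := funext (bernoulliProd_eq ρ)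
  rw [hν]
  have hw : ∀ η : Config d n, 0 < prodWt ρ η := prodWt_pos h0 h1
  set f := density μ (prodWt ρ) with hfdef
  have hf : ∀ η, 0 < f η := fun η => div_pos (hμ.pos hr η) (hw η)
  have hwf : ∀ η, prodWt ρ η * f η = μ η := fun η => mul_div_cancel₀ _ (hw η).ne'
  have hf1 : ∑ η, prodWt ρ η * f η = 1 := by
    simp only [hwf]; exact hμ.1.2
  have hinv : ∀ g : Config d n → ℝ, ∑ η, prodWt ρ η * f η * generator d n a b l g η = 0 := by
    simp only [hwf]
    exact ((isInvariantProb_iff a b l μ).1 hμ).2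
  have hprod := energy_le_of_invariant hn hd h0 h1 hF hc hf hc0.le hinv
  have hcorr := abs_sum_correlation_le hn h0.le h1.le (fun η => (hf η).le) hf1
  have hls := entropy_le_flipEnergy h0.le h1.le (fun η => (hf η).le) hf1
  have hent := sum_mul_le_entropy_add_log (fun η => greenForm (centred ρ η)) hw hf hf1
    (sum_prodWt_exp_greenForm_le (d := d) (n := n) h0.le h1.le)
  have hH : relEntropy f (prodWt ρ) = ∑ η, prodWt ρ η * (f η * Real.log (f η)) := rfl
  rw [← hH] at hls hent
  set H := relEntropy f (prodWt ρ)
  set ε := l / (2 * d * ρ)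
  set W := ∑ η, prodWt ρ η * ((∑ x, centred ρ η x * adjOp (centred ρ η) x) * f η)
  set Φ := ∑ η, prodWt ρ η * (greenForm (centred ρ η) * f η)
  set T := greenTrace d n
  set D := (n : ℝ) ^ 2 * swapEnergy ρ f with hD
  have hT : 0 ≤ T := greenTrace_nonneg
  have hD0 : 0 ≤ D := by
    have : 0 ≤ swapEnergy ρ f := Finset.sum_nonneg fun j _ => Finset.sum_nonneg fun x _ =>
      Finset.sum_nonneg fun η _ => mul_nonneg (hw η).le (sq_nonneg _)
    positivity
  have hε0 := abs_nonneg ε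
  have hdpos : (0 : ℝ) ≤ d := Nat.cast_nonneg d
  have hW : ε * W ≤ |ε| * (D / 4 + (2 * d + 8 * (d : ℝ) ^ 2) * Φ + 3 * d * T) :=
    (le_abs_self _).trans ((abs_mul ε W).le.trans (mul_le_mul_of_nonneg_left hcorr hε0))
  have hM : 0 ≤ 2 * d + 8 * (d : ℝ) ^ 2 := by positivity
  have hΦ : |ε| * (2 * d + 8 * (d : ℝ) ^ 2) * Φ ≤ |ε| * (2 * d + 8 * (d : ℝ) ^ 2) * (H + T) :=
    mul_le_mul_of_nonneg_left hent (mul_nonneg hε0 hM)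
  have hb1 : |ε| * (D / 4) ≤ D := by nlinarith
  have hb2 : |ε| * (3 * d * T) ≤ 3 * d * T :=
    mul_le_of_le_one_left (by positivity) hl1
  have hb3 : |ε| * (2 * d + 8 * (d : ℝ) ^ 2) * T ≤ (2 * d + 8 * (d : ℝ) ^ 2) * T :=
    mul_le_mul_of_nonneg_right (mul_le_of_le_one_left hM hl1) hT
  have hlsc : c * H ≤ 2 * (c * ∑ x, flipEnergy ρ x f) := by nlinarith
  have hfin : c * H ≤ 4 * ((5 * d + 8 * (d : ℝ) ^ 2) * T) := by
    -- Only `H ≥ 0` permits multiplying the smallness condition by `H`; for `H ≤ 0` the bound is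
    -- trivial, so nonnegativity of entropy is not required.
    rcases le_total 0 H with hHn | hHn
    · have hb4 : |ε| * (2 * d + 8 * (d : ℝ) ^ 2) * H ≤ c / 4 * H :=
        mul_le_mul_of_nonneg_right hl2 hHn
      linarith
    · have h5 : 0 ≤ (5 * d + 8 * (d : ℝ) ^ 2) * T := by positivity
      nlinarith
  have e : 4 / c * (5 * d + 8 * (d : ℝ) ^ 2) * T = 4 * ((5 * d + 8 * (d : ℝ) ^ 2) * T) / c := by
    ring
  rw [e, le_div_iff₀ hc0]
  linarith

-- For `n ≤ 2` the target order stays away from zero, so a constant multiple of it dominates the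
-- crude entropy bound.
omit [NeZero n] in
theorem half_le_order (hd : 1 ≤ d) (hn : n = 1 ∨ n = 2) (h2 : d = 2 → 2 ≤ n) :
    1 / 2 ≤ (n : ℝ) ^ ((d : ℤ) - 2) * greenOrder d n := by
  rcases (by omega : d = 1 ∨ d = 2 ∨ 3 ≤ d) with rfl | rfl | hd3
  · rcases hn with rfl | rfl <;> norm_num [greenOrder, zpow_neg]
  · obtain rfl : n = 2 := by omega
    have := Real.log_two_gt_d9
    norm_num [greenOrder]
    linarith
  · rw [greenOrder, if_neg (by omega), if_neg (by omega), mul_one]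
    have : (1 : ℝ) ≤ (n : ℝ) ^ ((d : ℤ) - 2) :=
      one_le_zpow₀ (by rcases hn with rfl | rfl <;> norm_num) (by omega)
    linarith

theorem order_nonneg (d n : ℕ) : 0 ≤ (n : ℝ) ^ ((d : ℤ) - 2) * greenOrder d n := by
  refine mul_nonneg (by positivity) ?_
  unfold greenOrder
  split_ifs
  · positivity
  · exact Real.log_natCast_nonneg n
  · norm_num

/-- Existence follows from `F(0) = a > 0 > -b = F(1)`. The difference of two values of `F` factors
through `l(1 - ρ - σ) - a - b`, which is negative for `|l| ≤ a / 2`. -/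
theorem existsUnique_reactionF_zero {a b l : ℝ} (ha : 0 < a) (hb : 0 < b) (hl : |l| ≤ a / 2) :
    ∃! ρ : ℝ, ρ ∈ Set.Icc (0 : ℝ) 1 ∧ reactionF a b l ρ = 0 := by
  obtain ⟨hl1, hl2⟩ := abs_le.1 hl
  have hcont : ContinuousOn (reactionF a b l) (Set.Icc 0 1) := by
    unfold reactionF; fun_prop
  have hmem : (0 : ℝ) ∈ Set.Icc (reactionF a b l 1) (reactionF a b l 0) := by
    constructor <;> simp [reactionF] <;> linarith
  obtain ⟨ρ, hρ, h⟩ := intermediate_value_Icc' zero_le_one hcont hmem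
  refine ⟨ρ, ⟨hρ, h⟩, fun σ ⟨hσ, h'⟩ => ?_⟩
  have e : (σ - ρ) * (l * (1 - ρ - σ) - a - b) = 0 := by
    unfold reactionF at h h'
    linear_combination h' - h
  rcases mul_eq_zero.1 e with h3 | h3
  · linarith
  · exfalso
    have : |l * (1 - ρ - σ)| ≤ a / 2 := by
      rw [abs_mul]
      have : |1 - ρ - σ| ≤ 1 := abs_le.2 ⟨by linarith [hρ.2, hσ.2], by linarith [hρ.1, hσ.1]⟩
      exact (mul_le_of_le_one_right (abs_nonneg _) this).trans hl
    linarith [(abs_le.1 this).2]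

/-- On `[0, 1]` the factor `a + lρ` lies between `a / 2` and `3a / 2`. The resulting bounds do not
depend on `l`, so neither do the final constants. -/
theorem reactionF_zero_bounds {a b l ρ : ℝ} (ha : 0 < a) (hb : 0 < b) (hl : |l| ≤ a / 2)
    (hρ : ρ ∈ Set.Icc (0 : ℝ) 1) (hF : reactionF a b l ρ = 0) :
    a / (a + 2 * b) ≤ ρ ∧ b / (2 * a + b) ≤ 1 - ρ := by
  obtain ⟨hl1, hl2⟩ := abs_le.1 hl
  obtain ⟨h0, h1⟩ := hρ
  unfold reactionF at hF
  have hlρ1 : -(a / 2) ≤ l * ρ := by nlinarith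
  have hlρ2 : l * ρ ≤ a / 2 := by nlinarith
  rw [div_le_iff₀ (by positivity), div_le_iff₀ (by positivity)]
  constructor <;> nlinarith

end Main

end ReactionDiffusion

open ReactionDiffusion in
theorem theorem2p2 (d : ℕ) (hd : 1 ≤ d) (a b : ℝ) (ha : 0 < a) (hb : 0 < b) :
    ∃ lc : ℝ, 0 < lc ∧ lc < a ∧ ∃ C : ℝ,
      ∀ l ∈ Set.Icc (-lc) lc,
        (∃! ρ : ℝ, ρ ∈ Set.Icc (0 : ℝ) 1 ∧ reactionF a b l ρ = 0) ∧
        ∀ ρ : ℝ, ρ ∈ Set.Icc (0 : ℝ) 1 → reactionF a b l ρ = 0 →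
          ∀ (n : ℕ) [NeZero n], (d = 2 → 2 ≤ n) →
            (∃! μ : Config d n → ℝ, IsInvariantProb d n a b l μ) ∧
            ∀ μ : Config d n → ℝ, IsInvariantProb d n a b l μ →
              relEntropy (density μ (bernoulliProd d n ρ)) (bernoulliProd d n ρ) ≤
                C * (n : ℝ) ^ ((d : ℤ) - 2) * greenOrder d n := by
  have hd' : (0 : ℝ) < d := by exact_mod_cast hd
  set c := min (a / 2) b with hc
  have hc0 : 0 < c := lt_min (by positivity) hb
  set M := 2 * d + 8 * (d : ℝ) ^ 2 with hM
  have hM0 : 0 < M := by positivity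
  -- The admissible size of `l / (2dρ)`: 1 absorbs the exclusion energy and `c / (4M)` absorbs the
  -- entropy.
  set δ := min 1 (c / (4 * M)) with hδ
  have hδ0 : 0 < δ := lt_min one_pos (by positivity)
  set ρ₀ := a / (a + 2 * b) with hρ₀
  have hρ₀0 : 0 < ρ₀ := by positivity
  set κ := min ρ₀ (b / (2 * a + b)) with hκ
  have hκ0 : 0 < κ := lt_min hρ₀0 (by positivity)
  have hκ1 : κ ≤ 1 := (min_le_left _ _).trans (by
    rw [hρ₀, div_le_one (by positivity)]; linarith)
  have hlog : 0 ≤ -Real.log κ := by linarith [Real.log_nonpos hκ0.le hκ1]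
  set C₁ := 4 / c * (5 * d + 8 * (d : ℝ) ^ 2) * (6 * d * 2 ^ d) with hC₁
  set C₂ := 2 * (2 ^ d * (-Real.log κ)) with hC₂
  have hC₁0 : 0 ≤ C₁ := by positivity
  have hC₂0 : 0 ≤ C₂ := by positivity
  -- `a / 2` keeps the rates positive, and `2dρ₀δ` forces `|l / (2dρ)| ≤ δ` because `ρ ≥ ρ₀`. `C₁`
  -- serves `n ≥ 3` and `C₂` serves `n ≤ 2`.
  refine ⟨min (a / 2) (2 * d * ρ₀ * δ), lt_min (by positivity) (by positivity),
    (min_le_left _ _).trans_lt (by linarith), C₁ + C₂, fun l hl => ?_⟩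
  have hl' : |l| ≤ min (a / 2) (2 * d * ρ₀ * δ) := abs_le.2 hl
  have hla := hl'.trans (min_le_left _ _)
  have hlδ := hl'.trans (min_le_right _ _)
  refine ⟨existsUnique_reactionF_zero ha hb hla, fun ρ hρ hF n _ h2 => ?_⟩
  obtain ⟨hρ0, hρ1⟩ := reactionF_zero_bounds ha hb hla hρ hF
  have hρpos : 0 < ρ := hρ₀0.trans_le hρ0
  have hρlt : ρ < 1 := by
    have : 0 < b / (2 * a + b) := by positivity
    linarith
  have hrate : ∀ x (η : Config d n), c ≤ rate a b l x η := fun x η => le_rate ha hd hla x η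
  refine ⟨existsUnique_isInvariantProb fun x η => hc0.trans_le (hrate x η), fun μ hμ => ?_⟩
  rw [mul_assoc]
  have hX := order_nonneg d n
  by_cases hn : 3 ≤ n
  · have hε : |l / (2 * d * ρ)| ≤ δ := by
      rw [abs_div, abs_of_pos (by positivity : 0 < 2 * d * ρ), div_le_iff₀ (by positivity)]
      refine hlδ.trans ?_
      have := mul_le_mul_of_nonneg_right hρ0 (by positivity : 0 ≤ 2 * d * δ)
      linarith
    have hεM : |l / (2 * d * ρ)| * M ≤ c / 4 := by
      have h3 : |l / (2 * d * ρ)| ≤ c / (4 * M) := hε.trans (min_le_right _ _)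
      rw [le_div_iff₀ (by positivity)] at h3
      linarith
    have hmain := relEntropy_le_greenTrace hn hd hρpos hρlt hF hc0 hrate
      (hε.trans (min_le_left _ _)) hεM hμ
    refine hmain.trans ?_
    have ht := mul_le_mul_of_nonneg_left (greenTrace_le (n := n) hd h2)
      (by positivity : 0 ≤ 4 / c * (5 * d + 8 * (d : ℝ) ^ 2))
    have := mul_nonneg hC₂0 hX
    rw [hC₁]
    linarith
  · have hn12 : n = 1 ∨ n = 2 := by
      have := NeZero.pos n
      omega
    have hcrude := relEntropy_le_of_le hκ0 ((min_le_left _ _).trans hρ0)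
      ((min_le_right _ _).trans hρ1) hμ.1
    have hhalf := half_le_order hd hn12 h2
    have hpow : (n : ℝ) ^ d ≤ 2 ^ d := by
      refine pow_le_pow_left₀ (by positivity) ?_ d
      rcases hn12 with h | h <;> rw [h] <;> norm_num
    calc _ ≤ (n : ℝ) ^ d * (-Real.log κ) := hcrude
      _ ≤ 2 ^ d * (-Real.log κ) := mul_le_mul_of_nonneg_right hpow hlog
      _ = C₂ * (1 / 2) := by rw [hC₂]; ring
      _ ≤ C₂ * ((n : ℝ) ^ ((d : ℤ) - 2) * greenOrder d n) :=
        mul_le_mul_of_nonneg_left hhalf hC₂0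
      _ ≤ _ := by
        have := mul_nonneg hC₁0 hX
        linarith
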